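/- For an integer $m\ge 3$ put $\zeta=e^{2\pi i/m}$ and $p_k=\zeta^k+\overline{\zeta}^{\,k}$. For a real number $w>0$ in $\mathbb{Q}(\zeta)$ let $$\Gamma=\Gamma(m,w)=\left\{A\in GL(2,\mathbb{Z}[\zeta])\ \middle|\ \begin{pmatrix}-1&0\\0&w\end{pmatrix}=A^{t}\begin{pmatrix}-1&0\\0&w\end{pmatrix}\overline{A}\right\}.$$ For integers $a,b,c\ge 2$, a subgroup of $PGL(2,\mathbb{C})$ is called a Schwarz triangle group of type $(a,b,c)$ if it is conjugate in $PGL(2,\mathbb{C})$ to the group of orientation preserving isometries of the hyperbolic upper half plane that is generated by all products of two of the three reflections in the sides of a hyperbolic triangle with angles $\pi/a$, $\pi/b$, $\pi/c$. Theorem 3.6. The image of $\Gamma(m,w)$ in $PGL(2,\mathbb{C})$ is a Schwarz triangle group - of type $(2,12,12)$ for $m=12$ and $w=2p_1(p_1+2)$, - of type $(2,10,10)$ for $m=10$ and $w=2p_1^3$, - of type $(2,3,18)$ for $m=18$ and $w=p_1(p_1+2)$, - of type $(2,3,14)$ for $m=14$ and $w=(-p_5)^{-1}$, - of type $(2,3,12)$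 for $m=12$ and $w=(p_1+1)^{-1}$. -/

import Mathlib

open scoped MatrixGroups ComplexConjugate

noncomputable section

namespace TriangleGroups

/-- The primitive `m`-th root of unity `ζ = exp (2 π i / m)`. -/
def zeta (m : ℕ) : ℂ := Complex.exp (2 * Real.pi * Complex.I / m)

/-- `p m k = ζ ^ k + conj ζ ^ k` where `ζ = exp (2 π i / m)`. -/
def p (m k : ℕ) : ℂ := zeta m ^ k + conj (zeta m) ^ k

/-- The ring `ℤ[ζ]` as a subring of `ℂ`. -/
abbrev cyclotomicIntegers (m : ℕ) : Subalgebra ℤ ℂ := Algebra.adjoin ℤ {zeta m}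

/-- The inclusion `GL(2, ℤ[ζ]) → GL(2, ℂ)`. -/
def toGLComplex (m : ℕ) : GL (Fin 2) (cyclotomicIntegers m) →* GL (Fin 2) ℂ :=
  Matrix.GeneralLinearGroup.map (algebraMap (cyclotomicIntegers m) ℂ)

/-- The matrix `diag(-1, w)`. -/
def hermitianForm (w : ℂ) : Matrix (Fin 2) (Fin 2) ℂ := !![-1, 0; 0, w]

/-- The group of all `A ∈ GL(2, ℂ)` with `diag(-1, w) = Aᵗ * diag(-1, w) * conj A`. -/
def unitaryGroup (w : ℂ) : Subgroup (GL (Fin 2) ℂ) where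
  carrier := {A | hermitianForm w =
    (A : Matrix (Fin 2) (Fin 2) ℂ).transpose * hermitianForm w *
      (A : Matrix (Fin 2) (Fin 2) ℂ).map (starRingEnd ℂ)}
  one_mem' := by simp
  mul_mem' := by
    intro A B hA hB
    simp only [Set.mem_ofPred_eq] at hA hB ⊢
    conv_lhs => rw [hB, hA]
    simp only [Units.val_mul, Matrix.transpose_mul, Matrix.map_mul, Matrix.mul_assoc]
  inv_mem' := by
    intro A hA
    simp only [Set.mem_ofPred_eq] at hA ⊢
    have h1 : (A : Matrix (Fin 2) (Fin 2) ℂ) * (A⁻¹ : GL (Fin 2) ℂ) = 1 := by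
      rw [← Units.val_mul, mul_inv_cancel, Units.val_one]
    have h2 : ((A⁻¹ : GL (Fin 2) ℂ) : Matrix (Fin 2) (Fin 2) ℂ).transpose *
        (A : Matrix (Fin 2) (Fin 2) ℂ).transpose = 1 := by
      rw [← Matrix.transpose_mul, h1, Matrix.transpose_one]
    have h3 : (A : Matrix (Fin 2) (Fin 2) ℂ).map (starRingEnd ℂ) *
        ((A⁻¹ : GL (Fin 2) ℂ) : Matrix (Fin 2) (Fin 2) ℂ).map (starRingEnd ℂ) = 1 := by
      rw [← Matrix.map_mul, h1]
      simp
    conv_rhs => rw [hA]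
    simp only [Matrix.mul_assoc]
    rw [h3, ← Matrix.mul_assoc, h2, Matrix.mul_one, Matrix.one_mul]

/-- The group `Γ` of all `A ∈ GL(2, ℤ[ζ])` with `diag(-1, w) = Aᵗ * diag(-1, w) * conj A`. -/
def Gam (m : ℕ) (w : ℂ) : Subgroup (GL (Fin 2) (cyclotomicIntegers m)) :=
  (unitaryGroup w).comap (toGLComplex m)

/-- The image of `Γ` in `PGL(2, ℂ)`. -/
def projGam (m : ℕ) (w : ℂ) : Subgroup PGL(2, ℂ) :=
  (Gam m w).map (Matrix.ProjGenLinGroup.mk.comp (toGLComplex m))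

/-- The angle at the vertex `P` between the hyperbolic geodesic segments from `P` to `Q` and from
`P` to `R` in the upper half plane. The Cayley transform `z ↦ (z - P) / (z - conj P)` is conformal,
sends `P` to the centre of the unit disc and sends geodesics through `P` to diameters, so that
this is a Euclidean angle between vectors in `ℂ`. -/
def hyperbolicAngle (P Q R : UpperHalfPlane) : ℝ :=
  InnerProductGeometry.angle
    (((Q : ℂ) - (P : ℂ)) / ((Q : ℂ) - conj (P : ℂ)))
    (((R : ℂ) - (P : ℂ)) / ((R : ℂ) - conj (P : ℂ)))

/-- For points `P ≠ Q` of the upper half plane: `s` acts on the upper half plane as the reflection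
in the geodesic through `P` and `Q`. Indeed, in Mathlib's action of `GL(2, ℝ)` on the upper
half plane, a matrix of negative determinant acts as the orientation reversing isometry
`z ↦ (a * conj z + b) / (c * conj z + d)`, and the only orientation reversing isometry which fixes
`P` and `Q` is the reflection in the geodesic through these points. -/
def IsReflectionThrough (s : GL (Fin 2) ℝ) (P Q : UpperHalfPlane) : Prop :=
  s.det.val < 0 ∧ s • P = P ∧ s • Q = Q

/-- The natural homomorphism `GL(2, ℝ) → PGL(2, ℂ)`. -/
def realToPGL : GL (Fin 2) ℝ →* PGL(2, ℂ) :=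
  Matrix.ProjGenLinGroup.mk.comp (Matrix.GeneralLinearGroup.map Complex.ofRealHom)

/-- `G ≤ PGL(2, ℂ)` is a Schwarz triangle group of type `(a, b, c)`: up to conjugation in
`PGL(2, ℂ)` it is the group of orientation preserving isometries of the upper half plane which is
generated by the products of two reflections in sides of a hyperbolic triangle with the
angles `π / a`, `π / b`, `π / c`. -/
def IsSchwarzTriangleGroup (a b c : ℕ) (G : Subgroup PGL(2, ℂ)) : Prop :=
  2 ≤ a ∧ 2 ≤ b ∧ 2 ≤ c ∧
  ∃ P Q R : UpperHalfPlane, P ≠ Q ∧ Q ≠ R ∧ R ≠ P ∧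
    hyperbolicAngle P Q R = Real.pi / a ∧
    hyperbolicAngle Q R P = Real.pi / b ∧
    hyperbolicAngle R P Q = Real.pi / c ∧
    ∃ s t u : GL (Fin 2) ℝ,
      IsReflectionThrough s P Q ∧ IsReflectionThrough t Q R ∧ IsReflectionThrough u R P ∧
      ∃ h : PGL(2, ℂ),
        G = ((Subgroup.closure {s * t, t * u, u * s}).map realToPGL).map (MulAut.conj h).toMonoidHom

end TriangleGroups

end

/-!
A matrix in `Γ` has a first column `(a, c)` with `‖a‖ ^ 2 - w ‖c‖ ^ 2 = 1`, so `Γ` acts on the disc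
`‖z‖ ^ 2 < 1 / w` with the coordinate `z = c / a`, and `‖a‖` is `cosh (D / 2)`, where `D` is the
hyperbolic distance by which the centre is moved. In all five cases the triangle has a right angle,
an angle `π / m` at the centre and a third angle `π / b` with `b = m` or `b = 3`. The triangles
around the centre fill a regular polygon with `m` sides. The triangle group is generated by the
rotation `diag(1, ζ)` about the centre and by the half-turn `N` about the midpoint of a side of the
polygon; both lie in `Γ`, because the equation `‖a‖ sin (π / m) = cos (π / b)`, which expresses that
`N` moves the centre by twice the side of the triangle, has a solution in `ℤ[ζ]`
(`isSchwarzTriangleGroup_closure`, based on `exists_triangle`).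

Conversely, a given element of `Γ` is multiplied by elements `N diag(1, ζ ^ k)` so as to make `‖a‖`
smaller. If the centre is moved to a point outside the circumscribed disc of the polygon, then one
of the `m` neighbouring centres is closer to this point than the centre itself
(`exists_re_mul_zeta_pow_le`), and if the point is bounded away from that disc, then the gain is
bounded below (`exists_pos_le_gain`). So the descent ends with `c = 0`, provided that no element of
`Γ` with `c ≠ 0` moves the centre into the neighbourhood of the disc. An element with `c = 0` is
diagonal, and by Kronecker's theorem its entries are powers of `ζ` (`exists_eq_zeta_pow`). This is
`mk_mem_of_mem_Gam`.

The missing lower bound for `w ‖c‖ ^ 2` comes from arithmetic. All conjugates of `w` other than `w`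
itself are negative, so that `‖σ a‖ ^ 2 + |σ w| ‖σ c‖ ^ 2 = 1` bounds the other conjugates of
`‖c‖ ^ 2` from above, while the product of all conjugates is a positive integer. Hence
`w ‖c‖ ^ 2 ≥ |Norm w|` (`norm_le_mul_norm_sq`). That is enough in three cases. For the type
`(2, 10, 10)` the norm of `‖a‖ ^ 2` is used as well, and for `(2, 3, 12)`, where `w⁻¹` is an
integer, the entry `b` with `‖b‖ = w ‖c‖` takes the place of `c`.
-/

namespace TriangleGroups

section

open Polynomial

/-! ### The root of unity and its real part -/

lemma zeta_isPrimitiveRoot {m : ℕ} (hm : m ≠ 0) : IsPrimitiveRoot (zeta m) m :=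
  Complex.isPrimitiveRoot_exp m hm

lemma norm_zeta (m : ℕ) : ‖zeta m‖ = 1 := by
  rw [zeta, show (2 * Real.pi * Complex.I / m : ℂ) = ((2 * Real.pi / m : ℝ) : ℂ) * Complex.I by
    push_cast; ring]
  exact Complex.norm_exp_ofReal_mul_I _

lemma zeta_pow_eq (m j : ℕ) :
    zeta m ^ j = Complex.exp (((2 * Real.pi * j / m : ℝ) : ℂ) * Complex.I) := by
  rw [zeta, ← Complex.exp_nat_mul]
  congr 1
  push_cast
  ring

lemma zeta_mem (m : ℕ) : zeta m ∈ cyclotomicIntegers m :=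
  Algebra.self_mem_adjoin_singleton ℤ _

/-- The real number `p m j = 2 cos (2 π j / m)`; for `j` coprime to `m` these are the conjugates
of `p m 1`. -/
noncomputable def realP (m j : ℕ) : ℝ := 2 * Real.cos (2 * Real.pi * j / m)

lemma re_zeta_pow (m j : ℕ) : (zeta m ^ j).re = Real.cos (2 * Real.pi * j / m) := by
  rw [zeta_pow_eq, Complex.exp_ofReal_mul_I_re]

lemma p_eq_realP (m j : ℕ) : p m j = realP m j := by
  rw [p, ← map_pow, Complex.add_conj, re_zeta_pow, realP]

lemma conj_zeta_pow (m j : ℕ) : conj (zeta m ^ j) = (zeta m ^ j)⁻¹ :=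
  (Complex.inv_eq_conj (by rw [norm_pow, norm_zeta, one_pow])).symm

lemma conj_zeta_mem (m : ℕ) (hm : m ≠ 0) : conj (zeta m) ∈ cyclotomicIntegers m := by
  have h : conj (zeta m) = zeta m ^ (m - 1) := by
    have h1 : zeta m * zeta m ^ (m - 1) = 1 := by
      rw [← pow_succ', Nat.sub_add_cancel (Nat.one_le_iff_ne_zero.mpr hm),
        (zeta_isPrimitiveRoot hm).pow_eq_one]
    rw [← Complex.inv_eq_conj (norm_zeta m)]
    exact inv_eq_of_mul_eq_one_right h1
  rw [h]
  exact pow_mem (zeta_mem m) _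

lemma p_mem (m j : ℕ) (hm : m ≠ 0) : p m j ∈ cyclotomicIntegers m :=
  add_mem (pow_mem (zeta_mem m) _) (pow_mem (conj_zeta_mem m hm) _)

/-! ### Conjugates and norms -/

lemma mem_cyclotomicIntegers_iff {m : ℕ} {c : ℂ} :
    c ∈ cyclotomicIntegers m ↔ ∃ P : ℤ[X], aeval (zeta m) P = c := by
  rw [cyclotomicIntegers, Algebra.adjoin_singleton_eq_range_aeval, AlgHom.mem_range]

/-- On the unit circle every integral polynomial has the form `U (z + conj z) + z * V (z + conj z)`,
because `z ^ 2 = (z + conj z) * z - 1`. -/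
lemma exists_aeval_eq_add_mul (P : ℤ[X]) : ∃ U V : ℤ[X], ∀ z : ℂ, ‖z‖ = 1 →
    aeval z P = aeval (z + conj z) U + z * aeval (z + conj z) V := by
  induction P using Polynomial.induction_on' with
  | add P P' h h' =>
    obtain ⟨U, V, h⟩ := h
    obtain ⟨U', V', h'⟩ := h'
    refine ⟨U + U', V + V', fun z hz => ?_⟩
    simp only [map_add, h z hz, h' z hz]
    ring
  | monomial n a =>
    induction n with
    | zero => exact ⟨C a, 0, fun z _ => by simp⟩
    | succ n ih =>
      obtain ⟨U, V, h⟩ := ih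
      refine ⟨-V, U + X * V, fun z hz => ?_⟩
      have h1 : z * conj z = 1 := by rw [Complex.mul_conj', hz]; simp
      rw [← monomial_mul_X, map_mul, h z hz]
      simp only [map_add, map_neg, map_mul, aeval_X]
      linear_combination (-aeval (z + conj z) V) * h1

/-- The square of the absolute value of an integral polynomial on the unit circle is an integral
polynomial in `z + conj z`. -/
lemma exists_aeval_eq_norm_sq (P : ℤ[X]) : ∃ Q : ℤ[X], ∀ z : ℂ, ‖z‖ = 1 →
    aeval (2 * z.re) Q = ‖aeval z P‖ ^ 2 := by
  obtain ⟨U, V, h⟩ := exists_aeval_eq_add_mul P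
  refine ⟨U ^ 2 + V ^ 2 + X * U * V, fun z hz => ?_⟩
  have h1 : z * conj z = 1 := by rw [Complex.mul_conj', hz]; simp
  have hre : ∀ G : ℤ[X], aeval (z + conj z) G = ((aeval (2 * z.re) G : ℝ) : ℂ) := fun G => by
    rw [Complex.add_conj]
    exact aeval_algebraMap_apply ℂ (2 * z.re) G
  have hz2 : ((2 * z.re : ℝ) : ℂ) = z + conj z := (Complex.add_conj z).symm
  apply Complex.ofReal_injective
  rw [Complex.ofReal_pow, ← Complex.mul_conj', h z hz, hre, hre]
  simp only [map_add, map_mul, map_pow, aeval_X, Complex.conj_ofReal, Complex.ofReal_add,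
    Complex.ofReal_mul, Complex.ofReal_pow] at hz2 ⊢
  rw [hz2]
  linear_combination (-(((aeval (2 * z.re) V : ℝ) : ℂ)) ^ 2) * h1

lemma aeval_zeta_pow_eq_zero_iff {m j : ℕ} (hm : m ≠ 0) (hj : j.Coprime m) (G : ℤ[X]) :
    aeval (zeta m ^ j) G = 0 ↔ aeval (zeta m) G = 0 := by
  have hz := zeta_isPrimitiveRoot hm
  have hpos := Nat.pos_of_ne_zero hm
  have h1 : IsIntegral ℤ (zeta m) := hz.isIntegral hpos
  have h2 : IsIntegral ℤ (zeta m ^ j) := h1.pow j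
  rw [minpoly.isIntegrallyClosed_dvd_iff h1, minpoly.isIntegrallyClosed_dvd_iff h2,
    ← hz.minpoly_eq_pow_coprime hj]

lemma aeval_realP_eq_zero_iff {m j : ℕ} (hm : m ≠ 0) (hj : j.Coprime m) (G : ℤ[X]) :
    aeval (realP m j) G = 0 ↔ aeval (realP m 1) G = 0 := by
  -- the real conjugation is the restriction of the one on `ℤ[ζ]`, as `conj ζ = ζ ^ (m - 1)`
  have key : ∀ i : ℕ, aeval (zeta m ^ i) (G.comp (X + X ^ (m - 1))) =
      ((aeval (realP m i) G : ℝ) : ℂ) := by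
    intro i
    have h1 : (zeta m ^ i) ^ (m - 1) = conj (zeta m ^ i) := by
      rw [conj_zeta_pow]
      refine eq_inv_of_mul_eq_one_left ?_
      rw [← pow_succ, Nat.sub_add_cancel (Nat.one_le_iff_ne_zero.mpr hm), ← pow_mul, mul_comm,
        pow_mul, (zeta_isPrimitiveRoot hm).pow_eq_one, one_pow]
    rw [aeval_comp, map_add, map_pow, aeval_X, h1, Complex.add_conj, re_zeta_pow]
    exact aeval_algebraMap_apply ℂ (realP m i) G
  have h := aeval_zeta_pow_eq_zero_iff hm hj (G.comp (X + X ^ (m - 1)))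
  have h' := key 1
  rw [pow_one] at h'
  rw [key, h', Complex.ofReal_eq_zero, Complex.ofReal_eq_zero] at h
  exact h

/-- The product of the values of an integral polynomial at all roots of a monic integral polynomial
is an integer. -/
lemma exists_int_eq_prod_aeval {ι : Type*} (J : Finset ι) (x : ι → ℝ) (f : ℤ[X])
    (hf : f.map (Int.castRingHom ℝ) = ∏ j ∈ J, (X - C (x j))) (Q : ℤ[X]) :
    ∃ N : ℤ, ∏ j ∈ J, aeval (x j) Q = N := by
  refine ⟨resultant f Q J.card Q.natDegree, ?_⟩
  have h1 : (∏ j ∈ J, (X - C (x j))).natDegree = J.card := by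
    simp [natDegree_prod_of_monic _ _ fun j _ => monic_X_sub_C (x j)]
  have h2 : (Q.map (Int.castRingHom ℝ)).natDegree ≤ Q.natDegree := natDegree_map_le
  have h := resultant_prod_left J (fun j => X - C (x j)) (Q.map (Int.castRingHom ℝ)) Q.natDegree
    (by simp) h2
  rw [h1, ← hf, resultant_map_map] at h
  rw [← eq_intCast (Int.castRingHom ℝ), h]
  refine Finset.prod_congr rfl fun j _ => ?_
  rw [natDegree_X_sub_C, resultant_X_sub_C_left _ _ _ h2, eval_map, aeval_def]
  rfl

/-- The relation `‖a‖ ^ 2 - W ‖c‖ ^ 2 = 1` in `ℤ[ζ]` has conjugates: the values of `‖a‖ ^ 2` and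
`‖c‖ ^ 2` under the conjugations indexed by `J` are positive, satisfy the conjugate relations, and
have products at least `1`, since these products are norms of nonzero integers. -/
lemma exists_conjugates {m : ℕ} (hm : m ≠ 0) {J : Finset ℕ} (hJ : ∀ j ∈ J, j.Coprime m)
    {f : ℤ[X]} (hf : f.map (Int.castRingHom ℝ) = ∏ j ∈ J, (X - C (realP m j))) (W : ℤ[X])
    {a c : ℂ} (ha : a ∈ cyclotomicIntegers m) (hc : c ∈ cyclotomicIntegers m) (ha0 : a ≠ 0)
    (hc0 : c ≠ 0) (hac : ‖a‖ ^ 2 - aeval (realP m 1) W * ‖c‖ ^ 2 = 1) :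
    ∃ x y : ℕ → ℝ, x 1 = ‖a‖ ^ 2 ∧ y 1 = ‖c‖ ^ 2 ∧
      (∀ j ∈ J, 0 < x j ∧ 0 < y j ∧ x j - aeval (realP m j) W * y j = 1) ∧
      1 ≤ ∏ j ∈ J, x j ∧ 1 ≤ ∏ j ∈ J, y j := by
  have key : ∀ d ∈ cyclotomicIntegers m, d ≠ 0 → ∃ Q : ℤ[X], aeval (realP m 1) Q = ‖d‖ ^ 2 ∧
      (∀ j ∈ J, 0 < aeval (realP m j) Q) ∧ 1 ≤ ∏ j ∈ J, aeval (realP m j) Q := by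
    intro d hd hd0
    obtain ⟨P, rfl⟩ := mem_cyclotomicIntegers_iff.mp hd
    obtain ⟨Q, hQ⟩ := exists_aeval_eq_norm_sq P
    have h1 : ∀ j, aeval (realP m j) Q = ‖aeval (zeta m ^ j) P‖ ^ 2 := fun j => by
      rw [← hQ _ (by rw [norm_pow, norm_zeta, one_pow]), re_zeta_pow, realP]
    have h2 : ∀ j ∈ J, 0 < aeval (realP m j) Q := fun j hj => by
      rw [h1]
      have := (aeval_zeta_pow_eq_zero_iff hm (hJ j hj) P).not.mpr hd0
      positivity
    refine ⟨Q, by rw [h1, pow_one], h2, ?_⟩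
    obtain ⟨N, hN⟩ := exists_int_eq_prod_aeval J (realP m) f hf Q
    have h3 := Finset.prod_pos h2
    rw [hN] at h3 ⊢
    exact_mod_cast h3
  obtain ⟨A, hA1, hA, hAn⟩ := key a ha ha0
  obtain ⟨Y, hY1, hY, hYn⟩ := key c hc hc0
  refine ⟨fun j => aeval (realP m j) A, fun j => aeval (realP m j) Y, hA1, hY1, fun j hj =>
    ⟨hA j hj, hY j hj, ?_⟩, hAn, hYn⟩
  have h := (aeval_realP_eq_zero_iff hm (hJ j hj) (A - W * Y - 1)).mpr (by
    rw [map_sub, map_sub, map_mul, map_one, hA1, hY1, hac, sub_self])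
  rw [map_sub, map_sub, map_mul, map_one] at h
  linarith

/-- If `W` is negative at all conjugates but the given one, then the solutions of
`‖a‖ ^ 2 - W ‖c‖ ^ 2 = 1` with `c ≠ 0` satisfy `W ‖c‖ ^ 2 ≥ |Norm W|`: at the other conjugates
`|W| ‖c‖ ^ 2` is at most `1`. -/
lemma norm_le_mul_norm_sq {m : ℕ} (hm : m ≠ 0) {J : Finset ℕ} (hJ : ∀ j ∈ insert 1 J, j.Coprime m)
    (hJ1 : 1 ∉ J) {f : ℤ[X]}
    (hf : f.map (Int.castRingHom ℝ) = ∏ j ∈ insert 1 J, (X - C (realP m j))) (W : ℤ[X])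
    (hW1 : 0 ≤ aeval (realP m 1) W) (hW : ∀ j ∈ J, aeval (realP m j) W ≤ 0)
    {a c : ℂ} (ha : a ∈ cyclotomicIntegers m) (hc : c ∈ cyclotomicIntegers m)
    (hc0 : c ≠ 0) (hac : ‖a‖ ^ 2 - aeval (realP m 1) W * ‖c‖ ^ 2 = 1) :
    aeval (realP m 1) W * ∏ j ∈ J, -aeval (realP m j) W ≤ aeval (realP m 1) W * ‖c‖ ^ 2 := by
  have ha0 : a ≠ 0 := by
    rintro rfl
    have : 0 ≤ aeval (realP m 1) W * ‖c‖ ^ 2 := by positivity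
    norm_num at hac
    linarith
  obtain ⟨x, y, -, hy1, hxy, -, hy⟩ := exists_conjugates hm hJ hf W ha hc ha0 hc0 hac
  rw [Finset.prod_insert hJ1, hy1] at hy
  have h1 : (∏ j ∈ J, -aeval (realP m j) W) * ∏ j ∈ J, y j ≤ 1 := by
    rw [← Finset.prod_mul_distrib]
    refine Finset.prod_le_one (fun j hj => ?_) fun j hj => ?_
    · exact mul_nonneg (neg_nonneg.mpr (hW j hj)) (hxy j (Finset.mem_insert_of_mem hj)).2.1.le
    · have := hxy j (Finset.mem_insert_of_mem hj)
      linarith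
  have h2 : 0 ≤ ∏ j ∈ J, -aeval (realP m j) W :=
    Finset.prod_nonneg fun j hj => neg_nonneg.mpr (hW j hj)
  refine mul_le_mul_of_nonneg_left ?_ hW1
  calc _ ≤ (∏ j ∈ J, -aeval (realP m j) W) * (‖c‖ ^ 2 * ∏ j ∈ J, y j) :=
        le_mul_of_one_le_right h2 hy
    _ = ‖c‖ ^ 2 * ((∏ j ∈ J, -aeval (realP m j) W) * ∏ j ∈ J, y j) := by ring
    _ ≤ ‖c‖ ^ 2 := mul_le_of_le_one_right (by positivity) h1

/-! ### Roots of unity in the ring of cyclotomic integers -/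

/-- In the `m`-th cyclotomic field with `m` even, the roots of unity have order dividing `m`. -/
lemma pow_eq_one_of_isOfFinOrder {m : ℕ} [NeZero m] (hm2 : 2 ∣ m) {K : Type*} [Field K]
    [NumberField K] [IsCyclotomicExtension {m} ℚ K] {x : K} (hx : IsOfFinOrder x) : x ^ m = 1 := by
  have hm := Nat.pos_of_neZero m
  have horder := IsPrimitiveRoot.orderOf x
  have ho0 := hx.orderOf_pos
  have htot := horder.lcm_totient_le_finrank (IsCyclotomicExtension.zeta_spec m ℚ K)
    (cyclotomic.irreducible_rat (Nat.lcm_pos ho0 hm))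
  rw [IsCyclotomicExtension.finrank K (cyclotomic.irreducible_rat hm)] at htot
  have hdvd : Nat.lcm (orderOf x) m ∣ 2 * m :=
    Nat.lcm_dvd (horder.dvd_of_isCyclotomicExtension m ho0.ne') (dvd_mul_left _ _)
  obtain ⟨l, hl⟩ := Nat.dvd_lcm_right (orderOf x) m
  have hl2 : l ∣ 2 := by
    rw [hl, mul_comm 2 m] at hdvd
    exact Nat.dvd_of_mul_dvd_mul_left hm hdvd
  apply orderOf_dvd_iff_pow_eq_one.mp
  rcases (Nat.dvd_prime Nat.prime_two).mp hl2 with rfl | rfl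
  · rw [mul_one] at hl
    exact hl ▸ Nat.dvd_lcm_left (orderOf x) m
  · rw [hl, mul_comm, Nat.totient_mul_of_prime_of_dvd Nat.prime_two hm2] at htot
    have := Nat.totient_pos.mpr hm
    omega

/-- Kronecker's theorem in `ℤ[ζ]`: the elements of absolute value `1` are the powers of `ζ`, if `m`
is even. All their conjugates have absolute value `1`, because complex conjugation commutes with
the Galois action. -/
lemma exists_eq_zeta_pow {m : ℕ} (hm : m ≠ 0) (hm2 : 2 ∣ m) {c : ℂ}
    (hc : c ∈ cyclotomicIntegers m) (hc1 : ‖c‖ = 1) : ∃ k : ℕ, c = zeta m ^ k := by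
  have : NeZero m := ⟨hm⟩
  have hz := zeta_isPrimitiveRoot hm
  obtain ⟨P, rfl⟩ := mem_cyclotomicIntegers_iff.mp hc
  have : NeZero (m : ℚ) := ⟨Nat.cast_ne_zero.mpr hm⟩
  obtain ⟨K, _, _, _⟩ : ∃ (K : Type) (_ : Field K) (_ : NumberField K),
      IsCyclotomicExtension {m} ℚ K :=
    ⟨CyclotomicField m ℚ, inferInstance, inferInstance, by
      convert! CyclotomicField.isCyclotomicExtension m ℚ⟩
  have hμ := IsCyclotomicExtension.zeta_spec m ℚ K
  set μ := IsCyclotomicExtension.zeta m ℚ K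
  have hconj : ∀ φ : K →+* ℂ, ∃ j : ℕ, j.Coprime m ∧ φ μ = zeta m ^ j := fun φ => by
    obtain ⟨j, -, hj, h⟩ := (hz.isPrimitiveRoot_iff).mp (hμ.map_of_injective φ.injective)
    exact ⟨j, hj, h.symm⟩
  obtain ⟨Q, hQ⟩ := exists_aeval_eq_norm_sq P
  have hone : ∀ j : ℕ, j.Coprime m → ‖aeval (zeta m ^ j) P‖ = 1 := by
    intro j hj
    have h1 : ∀ i, aeval (realP m i) Q = ‖aeval (zeta m ^ i) P‖ ^ 2 := fun i => by
      rw [← hQ _ (by rw [norm_pow, norm_zeta, one_pow]), re_zeta_pow, realP]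
    have h2 := (aeval_realP_eq_zero_iff hm hj (Q - 1)).mpr (by
      rw [map_sub, map_one, h1, pow_one, hc1]; norm_num)
    rw [map_sub, map_one, h1, sub_eq_zero] at h2
    exact (pow_eq_one_iff_of_nonneg (norm_nonneg _) two_ne_zero).mp h2
  have hφ : ∀ φ : K →+* ℂ, φ (aeval μ P) = aeval (φ μ) P := fun φ =>
    (aeval_algHom_apply (φ.toIntAlgHom) μ P).symm
  have hint : IsIntegral ℤ (aeval μ P) :=
    IsIntegral.of_mem_of_fg _ (hμ.isIntegral (Nat.pos_of_ne_zero hm)).fg_adjoin_singleton _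
      (aeval_mem_adjoin_singleton ℤ μ)
  obtain ⟨n, hn, hxn⟩ := NumberField.Embeddings.pow_eq_one_of_norm_eq_one _ ℂ hint fun φ => by
    obtain ⟨j, hj, h⟩ := hconj φ
    rw [hφ, h, hone j hj]
  have h1 := pow_eq_one_of_isOfFinOrder hm2 (isOfFinOrder_iff_pow_eq_one.mpr ⟨n, hn, hxn⟩)
  obtain ⟨φ⟩ : Nonempty (K →+* ℂ) := inferInstance
  obtain ⟨j, hj, h⟩ := hconj φ
  have h2 : aeval (zeta m ^ j) (P ^ m - 1) = 0 := by
    rw [map_sub, map_pow, map_one, ← h, ← hφ, ← map_pow, h1, map_one, sub_self]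
  rw [aeval_zeta_pow_eq_zero_iff hm hj, map_sub, map_pow, map_one, sub_eq_zero] at h2
  obtain ⟨k, -, hk⟩ := hz.eq_pow_of_pow_eq_one h2
  exact ⟨k, hk.symm⟩

end

/-! ### The gain in the reduction step -/

/-- Some rotation by a power of `ζ` moves `z` to within the angle `π / m` of the negative real
axis. -/
lemma exists_re_mul_zeta_pow_le {m : ℕ} (hm : m ≠ 0) (z : ℂ) :
    ∃ k : ℕ, (z * zeta m ^ k).re ≤ -Real.cos (Real.pi / m) * ‖z‖ := by
  have hm1 : (1 : ℝ) ≤ m := by exact_mod_cast Nat.one_le_iff_ne_zero.mpr hm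
  have hm0 : (0 : ℝ) < m := by linarith
  have hpi := Real.pi_pos
  set x : ℝ := (Real.pi - z.arg) * m / (2 * Real.pi)
  set l : ℤ := round x
  have hl : |x - l| ≤ 1 / 2 := abs_sub_round x
  obtain ⟨k, hk⟩ : ∃ k : ℕ, (k : ℤ) = l + m * |l| := by
    refine ⟨(l + m * |l|).toNat, Int.toNat_of_nonneg ?_⟩
    have h1 : (1 : ℤ) ≤ m := by exact_mod_cast Nat.one_le_iff_ne_zero.mpr hm
    nlinarith [neg_abs_le l, abs_nonneg l]
  refine ⟨k, ?_⟩
  have hkr : (k : ℝ) = l + m * ((|l| : ℤ) : ℝ) := by exact_mod_cast hk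
  have h1 : (z * zeta m ^ k).re = ‖z‖ * Real.cos (z.arg + 2 * Real.pi * k / m) := by
    conv_lhs => rw [← Complex.norm_mul_exp_arg_mul_I z]
    rw [zeta_pow_eq, mul_assoc, ← Complex.exp_add, ← add_mul, ← Complex.ofReal_add,
      Complex.re_ofReal_mul, Complex.exp_ofReal_mul_I_re]
  have h2 : z.arg + 2 * Real.pi * k / m =
      (-((x - l) * (2 * Real.pi / m)) + Real.pi) + (|l| : ℤ) * (2 * Real.pi) := by
    rw [hkr]
    simp only [x]
    field_simp
    ring
  rw [h1, h2, Real.cos_add_int_mul_two_pi, Real.cos_add_pi, Real.cos_neg, ← Real.cos_abs]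
  have h3 : |(x - l) * (2 * Real.pi / m)| ≤ Real.pi / m := by
    rw [abs_mul, abs_of_pos (by positivity : 0 < 2 * Real.pi / m)]
    calc _ ≤ 1 / 2 * (2 * Real.pi / m) := by gcongr
      _ = _ := by ring
  have h4 := Real.cos_le_cos_of_nonneg_of_le_pi (abs_nonneg _)
    (div_le_self hpi.le hm1) h3
  nlinarith [norm_nonneg z]

/-- The uniform gain in the reduction step. In hyperbolic terms, `x = cosh (D / 2)` for a point at
distance `D` from the centre of a regular polygon with central angle `2 A` and vertex angle `2 B`;
the condition on `δ` says that the point is bounded away from the circumscribed disc, so that some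
neighbouring centre is closer to it than the given one. -/
lemma exists_pos_le_gain {sA cA sB cB α w r δ : ℝ} (hA : sA ^ 2 + cA ^ 2 = 1)
    (hB : sB ^ 2 + cB ^ 2 = 1) (hsA : 0 < sA) (hcA : 0 ≤ cA) (hsB : 0 < sB) (hcB : 0 ≤ cB)
    (hw : 0 < w) (hr : 0 < r) (hα : α * sA = cB) (hαr : α ^ 2 - w * r ^ 2 = 1) (hδ0 : 0 ≤ δ)
    (hδ : cA * cB < (2 * δ + 1) * (sA * sB)) :
    ∃ ε > 0, ∀ x y : ℝ, 0 ≤ x → 0 ≤ y → x ^ 2 - w * y ^ 2 = 1 → δ ≤ w * y ^ 2 →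
      (α * x) ^ 2 + (w * r * y) ^ 2 - 2 * cA * (α * x * (w * r * y)) ≤ x ^ 2 - ε := by
  set S : ℝ := √w * r * sA
  have hS0 : 0 < S := by positivity
  have hww : √w ^ 2 = w := Real.sq_sqrt hw.le
  have hS : S ^ 2 = cB ^ 2 - sA ^ 2 := by
    simp only [S]
    rw [mul_pow, mul_pow, hww, ← hα]
    linear_combination (-sA ^ 2) * hαr
  have hS1 : S ≤ 1 := by nlinarith [sq_nonneg sA, sq_nonneg sB]
  have hcc : cA * cB ≤ 1 := by nlinarith [sq_nonneg (cA - cB)]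
  have hcc0 : 0 ≤ cA * cB := mul_nonneg hcA hcB
  set κ : ℝ := sA ^ 2 * sB ^ 2 - (cA * cB) ^ 2 / (2 * δ + 1) ^ 2
  have hκ : 0 < κ := by
    have h1 : (cA * cB) ^ 2 < ((2 * δ + 1) * (sA * sB)) ^ 2 := pow_lt_pow_left₀ hδ hcc0 two_ne_zero
    rw [sub_pos, div_lt_iff₀ (by positivity)]
    linarith
  refine ⟨S * κ / (2 * sA ^ 2), by positivity, fun x y hx hy hxy hyδ => ?_⟩
  set u : ℝ := 2 * w * y ^ 2 + 1
  have hu : 2 * δ + 1 ≤ u := by simp only [u]; linarith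
  have hu1 : 1 ≤ u := by linarith
  set z : ℝ := 2 * √w * y * x
  have hz0 : 0 ≤ z := by positivity
  have hz : z ^ 2 = u ^ 2 - 1 := by
    simp only [z, u]
    rw [mul_pow, mul_pow, mul_pow, hww]
    linear_combination 4 * w * y ^ 2 * hxy
  have hzu : z ≤ u := abs_le_of_sq_le_sq' (by linarith) (by linarith) |>.2
  have hpq : κ * u ^ 2 ≤ (cA * cB * z - S * u) * (cA * cB * z + S * u) := by
    have h1 : (cA * cB * z - S * u) * (cA * cB * z + S * u) =
        sA ^ 2 * sB ^ 2 * u ^ 2 - (cA * cB) ^ 2 := by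
      have hsB2 : sB ^ 2 = 1 - cB ^ 2 := by linarith
      have hcA2 : cA ^ 2 = 1 - sA ^ 2 := by linarith
      calc _ = cA ^ 2 * cB ^ 2 * z ^ 2 - S ^ 2 * u ^ 2 := by ring
        _ = _ := by rw [hz, hS, mul_pow, hsB2, hcA2]; ring
    have h2 : (cA * cB) ^ 2 ≤ (cA * cB) ^ 2 / (2 * δ + 1) ^ 2 * u ^ 2 := by
      rw [div_mul_eq_mul_div, le_div_iff₀ (by positivity)]
      gcongr
    rw [h1]
    simp only [κ]
    linarith
  have hsum : cA * cB * z + S * u ≤ 2 * u := by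
    have h1 : cA * cB * z ≤ 1 * u := mul_le_mul hcc hzu hz0 zero_le_one
    have h2 : S * u ≤ 1 * u := mul_le_mul_of_nonneg_right hS1 (by linarith)
    linarith
  have hgain : κ / 2 ≤ cA * cB * z - S * u := by
    have h0 : 0 ≤ cA * cB * z - S * u := by
      by_contra! hneg
      have h1 : 0 ≤ cA * cB * z + S * u := by positivity
      have h2 : 0 < κ * u ^ 2 := by positivity
      linarith [mul_nonpos_of_nonpos_of_nonneg hneg.le h1]
    have h1 : κ * u ^ 2 ≤ (cA * cB * z - S * u) * (2 * u) :=
      hpq.trans (mul_le_mul_of_nonneg_left hsum h0)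
    have h2 : κ * u ≤ (cA * cB * z - S * u) * 2 := by
      refine le_of_mul_le_mul_right ?_ (by linarith : 0 < u)
      linarith
    have h3 : κ * 1 ≤ κ * u := mul_le_mul_of_nonneg_left hu1 hκ.le
    linarith
  have hfin : sA ^ 2 * (x ^ 2 - ((α * x) ^ 2 + (w * r * y) ^ 2 - 2 * cA * (α * x * (w * r * y)))) =
      S * (cA * cB * z - S * u) := by
    have h3 : S * (cA * cB * z - S * u) = 2 * cA * cB * w * r * sA * x * y - S ^ 2 * u := by
      simp only [z, S]
      linear_combination (2 * r * sA * cA * cB * y * x) * hww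
    have h4 : S ^ 2 = w * r ^ 2 * sA ^ 2 := by
      simp only [S]; rw [mul_pow, mul_pow, hww]
    rw [h3, h4, ← hα]
    simp only [u]
    linear_combination (-sA ^ 2 * x ^ 2) * hαr - (sA ^ 2 * w * r ^ 2) * hxy
  have h5 : S * (κ / 2) ≤ sA ^ 2 * (x ^ 2 - ((α * x) ^ 2 + (w * r * y) ^ 2 -
      2 * cA * (α * x * (w * r * y)))) := by
    rw [hfin]
    gcongr
  have h6 : S * κ / (2 * sA ^ 2) ≤ x ^ 2 - ((α * x) ^ 2 + (w * r * y) ^ 2 -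
      2 * cA * (α * x * (w * r * y))) := by
    rw [div_le_iff₀ (by positivity)]
    linarith
  linarith

/-! ### Generators of the unitary group -/

/-- The relations between the columns of a unitary matrix; the last one says that its rows are
unitary in the dual sense. -/
lemma entries_of_mem_unitaryGroup {w : ℝ} (hw : 0 < w) {g : GL (Fin 2) ℂ}
    (hg : g ∈ unitaryGroup w) :
    ‖g 0 0‖ ^ 2 - w * ‖g 1 0‖ ^ 2 = 1 ∧ w * ‖g 1 1‖ ^ 2 - ‖g 0 1‖ ^ 2 = w ∧
      g 0 0 * conj (g 0 1) = w * (g 1 0 * conj (g 1 1)) ∧ ‖g 0 1‖ = w * ‖g 1 0‖ := by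
  have hg' : hermitianForm w = (g : Matrix (Fin 2) (Fin 2) ℂ).transpose * hermitianForm w *
      (g : Matrix (Fin 2) (Fin 2) ℂ).map (starRingEnd ℂ) := hg
  have h00 := congrFun (congrFun hg' 0) 0
  have h11 := congrFun (congrFun hg' 1) 1
  have h01 := congrFun (congrFun hg' 0) 1
  simp [hermitianForm, Matrix.mul_apply, Fin.sum_univ_two] at h00 h11 h01
  have e00 : ‖g 0 0‖ ^ 2 - w * ‖g 1 0‖ ^ 2 = 1 := by
    apply Complex.ofReal_injective
    push_cast
    rw [← Complex.mul_conj', ← Complex.mul_conj']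
    linear_combination h00
  have e11 : w * ‖g 1 1‖ ^ 2 - ‖g 0 1‖ ^ 2 = w := by
    apply Complex.ofReal_injective
    push_cast
    rw [← Complex.mul_conj', ← Complex.mul_conj']
    linear_combination -h11
  have e01 : g 0 0 * conj (g 0 1) = w * (g 1 0 * conj (g 1 1)) := by linear_combination h01
  refine ⟨e00, e11, e01, ?_⟩
  have hn : ‖g 0 0‖ * ‖g 0 1‖ = w * (‖g 1 0‖ * ‖g 1 1‖) := by
    have := congrArg norm e01
    simpa [abs_of_pos hw] using this
  have hn2 : ‖g 0 0‖ ^ 2 * ‖g 0 1‖ ^ 2 = w ^ 2 * (‖g 1 0‖ ^ 2 * ‖g 1 1‖ ^ 2) := by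
    rw [← mul_pow, hn]; ring
  have : ‖g 0 1‖ ^ 2 = (w * ‖g 1 0‖) ^ 2 := by
    linear_combination hn2 - ‖g 0 1‖ ^ 2 * e00 + w * ‖g 1 0‖ ^ 2 * e11
  exact (pow_left_inj₀ (norm_nonneg _) (by positivity) two_ne_zero).mp this

/-- A unitary matrix over `ℤ[ζ]` whose determinant is a unit comes from `Γ`. -/
lemma exists_mem_Gam {m : ℕ} {w : ℂ} {M : Matrix (Fin 2) (Fin 2) ℂ}
    (hM : ∀ i j, M i j ∈ cyclotomicIntegers m) {e : ℂ} (he : e ∈ cyclotomicIntegers m)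
    (hdet : M.det * e = 1)
    (hu : hermitianForm w = M.transpose * hermitianForm w * M.map (starRingEnd ℂ)) :
    ∃ A ∈ Gam m w, (toGLComplex m A : Matrix (Fin 2) (Fin 2) ℂ) = M := by
  let M' : Matrix (Fin 2) (Fin 2) (cyclotomicIntegers m) := fun i j => ⟨M i j, hM i j⟩
  have hdet' : IsUnit M'.det := by
    refine IsUnit.of_mul_eq_one (⟨e, he⟩ : cyclotomicIntegers m) (Subtype.ext ?_)
    rw [Matrix.det_fin_two] at hdet ⊢
    simpa [M'] using hdet
  have h : (toGLComplex m (Matrix.GeneralLinearGroup.mk'' M' hdet') :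
      Matrix (Fin 2) (Fin 2) ℂ) = M := by
    ext i j
    rfl
  refine ⟨Matrix.GeneralLinearGroup.mk'' M' hdet', ?_, h⟩
  change hermitianForm w = _
  rw [h]
  exact hu

lemma coe_rotation_pow {m : ℕ} {R : GL (Fin 2) ℂ}
    (hR : (R : Matrix (Fin 2) (Fin 2) ℂ) = !![1, 0; 0, zeta m]) (n : ℕ) :
    ((R ^ n : GL (Fin 2) ℂ) : Matrix (Fin 2) (Fin 2) ℂ) = !![1, 0; 0, zeta m ^ n] := by
  induction n with
  | zero => simp [Matrix.one_fin_two]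
  | succ n ih => rw [pow_succ, Units.val_mul, ih, hR]; simp [pow_succ]

open Matrix.ProjGenLinGroup in
/-- The diagonal elements of `Γ` act as powers of the rotation `diag(1, ζ)`. -/
lemma mk_mem_of_apply_one_zero_eq_zero {m : ℕ} (hm : m ≠ 0) (hm2 : 2 ∣ m) {w : ℝ} (hw : 0 < w)
    {R : GL (Fin 2) ℂ} (hR : (R : Matrix (Fin 2) (Fin 2) ℂ) = !![1, 0; 0, zeta m])
    {T : Subgroup PGL(2, ℂ)} (hRT : mk R ∈ T) {A : GL (Fin 2) (cyclotomicIntegers m)}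
    (hA : A ∈ Gam m w) (hc : toGLComplex m A 1 0 = 0) : mk (toGLComplex m A) ∈ T := by
  obtain ⟨h00, h11, -, h01⟩ := entries_of_mem_unitaryGroup hw (show toGLComplex m A ∈ _ from hA)
  rw [hc, norm_zero, mul_zero] at h01
  rw [hc, norm_zero] at h00
  rw [h01] at h11
  have ha : ‖toGLComplex m A 0 0‖ = 1 :=
    (pow_eq_one_iff_of_nonneg (norm_nonneg _) two_ne_zero).mp (by linarith)
  have hd : ‖toGLComplex m A 1 1‖ = 1 :=
    (pow_eq_one_iff_of_nonneg (norm_nonneg _) two_ne_zero).mp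
      (mul_left_cancel₀ hw.ne' (by linarith))
  obtain ⟨k, hk⟩ := exists_eq_zeta_pow hm hm2 (c := toGLComplex m A 0 0) (A 0 0).2 ha
  obtain ⟨l, hl⟩ := exists_eq_zeta_pow hm hm2 (c := toGLComplex m A 1 1) (A 1 1).2 hd
  have hz : zeta m ^ k ≠ 0 := pow_ne_zero _ (by rw [← norm_ne_zero_iff, norm_zeta]; norm_num)
  have h : mk (toGLComplex m A * R ^ k) = mk (R ^ l) := by
    rw [eq_comm, mk_eq_mk_iff]
    refine ⟨Units.mk0 _ hz, Units.ext ?_⟩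
    have hAv : (toGLComplex m A : Matrix (Fin 2) (Fin 2) ℂ) = !![zeta m ^ k, 0; 0, zeta m ^ l] := by
      rw [Matrix.eta_fin_two (toGLComplex m A : Matrix (Fin 2) (Fin 2) ℂ), hc, hk, hl,
        norm_eq_zero.mp h01]
    rw [Units.val_mul, Units.val_mul, coe_rotation_pow hR, coe_rotation_pow hR, hAv]
    ext i j
    fin_cases i <;> fin_cases j <;> simp [Matrix.mul_apply, Fin.sum_univ_two, mul_comm]
  rw [map_mul, map_pow, map_pow] at h
  rw [eq_mul_inv_of_mul_eq h]
  exact mul_mem (pow_mem hRT _) (inv_mem (pow_mem hRT _))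

open Matrix.ProjGenLinGroup in
/-- Reduction theory of `Γ`: if the solutions of `‖a‖ ^ 2 - w ‖c‖ ^ 2 = 1` that occur as first
columns in `Γ` are bounded away from the circumscribed disc of the polygon around the centre, then
the image of `Γ` is generated by the rotation `R` and the half-turn `N`. -/
lemma mk_mem_of_mem_Gam {m : ℕ} (hm : 2 ≤ m) (hm2 : 2 ∣ m) {w : ℝ} (hw : 0 < w)
    {a v : ℂ} {r δ B : ℝ} (hr : 0 < r) (hv : ‖v‖ = 1) (hB0 : 0 < B) (hB1 : B ≤ Real.pi / 2)
    (ha : ‖a‖ * Real.sin (Real.pi / m) = Real.cos B)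
    (har : ‖a‖ ^ 2 - w * r ^ 2 = 1) (hδ0 : 0 < δ)
    (hδ : Real.cos (Real.pi / m) * Real.cos B <
      (2 * δ + 1) * (Real.sin (Real.pi / m) * Real.sin B))
    (hmin : ∀ A ∈ Gam m w, toGLComplex m A 1 0 ≠ 0 → δ ≤ w * ‖toGLComplex m A 1 0‖ ^ 2)
    {R N : GL (Fin 2) (cyclotomicIntegers m)} (hRG : R ∈ Gam m w) (hNG : N ∈ Gam m w)
    (hR : (toGLComplex m R : Matrix (Fin 2) (Fin 2) ℂ) = !![1, 0; 0, zeta m])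
    (hN : (toGLComplex m N : Matrix (Fin 2) (Fin 2) ℂ) = !![a, v * w * r; -r, -a])
    {T : Subgroup PGL(2, ℂ)} (hRT : mk (toGLComplex m R) ∈ T) (hNT : mk (toGLComplex m N) ∈ T)
    {A : GL (Fin 2) (cyclotomicIntegers m)} (hA : A ∈ Gam m w) : mk (toGLComplex m A) ∈ T := by
  have hm0 : m ≠ 0 := by omega
  have hmr : (2 : ℝ) ≤ m := by exact_mod_cast hm
  have hpi := Real.pi_pos
  have hA1 : Real.pi / m ≤ Real.pi / 2 := by gcongr
  have hA0 : 0 < Real.pi / m := by positivity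
  obtain ⟨ε, hε, hgain⟩ := exists_pos_le_gain (Real.sin_sq_add_cos_sq (Real.pi / m))
    (Real.sin_sq_add_cos_sq B) (Real.sin_pos_of_pos_of_lt_pi hA0 (by linarith))
    (Real.cos_nonneg_of_neg_pi_div_two_le_of_le (by linarith) hA1)
    (Real.sin_pos_of_pos_of_lt_pi hB0 (by linarith))
    (Real.cos_nonneg_of_neg_pi_div_two_le_of_le (by linarith) hB1) hw hr ha har hδ0.le hδ
  have main : ∀ (n : ℕ) (A : GL (Fin 2) (cyclotomicIntegers m)), A ∈ Gam m w →
      ‖toGLComplex m A 0 0‖ ^ 2 ≤ 1 + n * ε → mk (toGLComplex m A) ∈ T := by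
    intro n
    induction n with
    | zero =>
      intro A hA hAn
      obtain ⟨h00, -⟩ := entries_of_mem_unitaryGroup hw (show toGLComplex m A ∈ _ from hA)
      refine mk_mem_of_apply_one_zero_eq_zero hm0 hm2 hw hR hRT hA ?_
      by_contra hne
      have := hmin A hA hne
      rw [Nat.cast_zero, zero_mul, add_zero] at hAn
      linarith
    | succ n ih =>
      intro A hA hAn
      obtain ⟨h00, -⟩ := entries_of_mem_unitaryGroup hw (show toGLComplex m A ∈ _ from hA)
      by_cases hc : toGLComplex m A 1 0 = 0
      · exact mk_mem_of_apply_one_zero_eq_zero hm0 hm2 hw hR hRT hA hc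
      obtain ⟨k, hk⟩ := exists_re_mul_zeta_pow_le hm0
        (conj (a * toGLComplex m A 0 0) * (v * w * r * toGLComplex m A 1 0))
      have hg := hgain _ _ (norm_nonneg _) (norm_nonneg _) h00 (hmin A hA hc)
      have hentry : toGLComplex m (N * R ^ k * A) 0 0 =
          a * toGLComplex m A 0 0 + v * w * r * toGLComplex m A 1 0 * zeta m ^ k := by
        rw [map_mul, map_mul, map_pow, Units.val_mul, Units.val_mul, hN, coe_rotation_pow hR]
        simp [Matrix.mul_apply, Fin.sum_univ_two]
        ring
      have hnorm : ‖toGLComplex m (N * R ^ k * A) 0 0‖ ^ 2 ≤ ‖toGLComplex m A 0 0‖ ^ 2 - ε := by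
        refine le_trans ?_ hg
        have h1 : (a * toGLComplex m A 0 0 * conj (v * w * r * toGLComplex m A 1 0 * zeta m ^ k)).re
            = (conj (a * toGLComplex m A 0 0) * (v * w * r * toGLComplex m A 1 0) *
              zeta m ^ k).re := by
          rw [← Complex.conj_re]
          congr 1
          simp only [map_mul, Complex.conj_conj]
          ring
        have h2 : ‖v * w * r * toGLComplex m A 1 0‖ = w * r * ‖toGLComplex m A 1 0‖ := by
          simp [hv, abs_of_pos hw, abs_of_pos hr]
        rw [hentry, Complex.sq_norm, Complex.normSq_add, h1, ← Complex.sq_norm, ← Complex.sq_norm,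
          norm_mul (_ * _) (zeta m ^ k), norm_pow (zeta m), norm_zeta, one_pow, mul_one, h2,
          norm_mul a]
        rw [norm_mul, h2, Complex.norm_conj, norm_mul a] at hk
        linarith
      have hmem : N * R ^ k * A ∈ Gam m w := mul_mem (mul_mem hNG (pow_mem hRG k)) hA
      have h := ih (N * R ^ k * A) hmem (by push_cast at hAn; linarith)
      rw [map_mul, map_mul, map_mul, map_mul, map_pow, map_pow] at h
      exact (Subgroup.mul_mem_cancel_left T (mul_mem hNT (pow_mem hRT k))).mp h
  obtain ⟨n, hn⟩ := exists_nat_ge ((‖toGLComplex m A 0 0‖ ^ 2 - 1) / ε)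
  exact main n A hA (by rw [div_le_iff₀ hε] at hn; linarith)

/-! ### The hyperbolic triangle -/

/-- Hyperbolic angles are determined by a product whose argument is that of the cross-ratio. -/
lemma hyperbolicAngle_eq {P Q R : UpperHalfPlane} (hQ : Q ≠ P) (hR : R ≠ P) {θ ρ : ℝ}
    (hθ : θ ∈ Set.Ioc (-Real.pi) Real.pi) (hρ : 0 < ρ)
    (h : ((Q : ℂ) - P) * (R - conj (P : ℂ)) * conj (((Q : ℂ) - conj (P : ℂ)) * (R - P)) =
      ρ * (Real.cos θ + Real.sin θ * Complex.I)) :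
    hyperbolicAngle P Q R = |θ| := by
  have hne : ∀ z : UpperHalfPlane, (z : ℂ) - conj (P : ℂ) ≠ 0 := fun z h0 => by
    have h1 := congrArg Complex.im h0
    have h2 := z.im_pos
    have h3 := P.im_pos
    simp at h1
    linarith
  have hQ' : (Q : ℂ) - P ≠ 0 := sub_ne_zero.mpr fun h0 => hQ (UpperHalfPlane.ext h0)
  have hR' : (R : ℂ) - P ≠ 0 := sub_ne_zero.mpr fun h0 => hR (UpperHalfPlane.ext h0)
  set d : ℂ := ((Q : ℂ) - conj (P : ℂ)) * (R - P)
  have hd : d ≠ 0 := mul_ne_zero (hne Q) hR'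
  have hd' : conj d ≠ 0 := (map_ne_zero _).mpr hd
  have hdd : ((‖d‖ ^ 2 : ℝ) : ℂ) = d * conj d := by
    rw [Complex.mul_conj']; push_cast; rfl
  have hn : 0 < ‖d‖ ^ 2 := by positivity
  rw [hyperbolicAngle, Complex.angle_eq_abs_arg (div_ne_zero hQ' (hne Q)) (div_ne_zero hR' (hne R))]
  have h4 : ((Q : ℂ) - P) / (Q - conj (P : ℂ)) / ((R - P) / (R - conj (P : ℂ))) =
      ((ρ / ‖d‖ ^ 2 : ℝ) : ℂ) * (Complex.cos θ + Complex.sin θ * Complex.I) := by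
    rw [Complex.ofReal_div, hdd, div_mul_eq_mul_div, ← Complex.ofReal_cos, ← Complex.ofReal_sin,
      ← h, mul_div_mul_right _ _ hd']
    simp only [d]
    have := hne Q
    have := hne R
    field_simp
  rw [h4, Complex.arg_mul_cos_add_sin_mul_I (by positivity) hθ]

lemma smul_eq_self_of_det_neg {g : GL (Fin 2) ℝ} (hg : g.det.val < 0) {z : UpperHalfPlane}
    (h : (g 0 0 : ℂ) * z + g 0 1 = conj (z : ℂ) * (g 1 0 * z + g 1 1)) : g • z = z := by
  apply UpperHalfPlane.ext
  have h1 : UpperHalfPlane.denom g z ≠ 0 := UpperHalfPlane.denom_ne_zero g z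
  rw [UpperHalfPlane.coe_smul, UpperHalfPlane.σ, if_neg hg.not_gt]
  rw [show UpperHalfPlane.num g z = conj (z : ℂ) * UpperHalfPlane.denom g z from h,
    mul_div_assoc, div_self h1]
  simp

/-- The triangle with vertices `i q`, `x + i y` and `i`, where `q = α + τ`, and where the first two
lie on the circle of radius `q` about `0`, so that there is a right angle at `i q`. The side from
`i` to `i q` has length `log q`, with hyperbolic cosine `α` and hyperbolic sine `τ`. -/
lemma exists_triangle {A B α τ : ℝ} (hA0 : 0 < A) (hA1 : A < Real.pi / 2) (hB0 : 0 < B)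
    (hB1 : B < Real.pi / 2) (hα : 0 < α) (hτ : 0 < τ) (hαA : α * Real.sin A = Real.cos B)
    (hατ : α ^ 2 - τ ^ 2 = 1) :
    ∃ P Q R : UpperHalfPlane, P ≠ Q ∧ Q ≠ R ∧ R ≠ P ∧ hyperbolicAngle P Q R = Real.pi / 2 ∧
      hyperbolicAngle Q R P = B ∧ hyperbolicAngle R P Q = A ∧
      ∃ s t u : GL (Fin 2) ℝ, IsReflectionThrough s P Q ∧ IsReflectionThrough t Q R ∧
        IsReflectionThrough u R P ∧
        (s : Matrix (Fin 2) (Fin 2) ℝ) = !![0, (α + τ) ^ 2; 1, 0] ∧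
        (t : Matrix (Fin 2) (Fin 2) ℝ) = !![-Real.cos A, Real.sin A; Real.sin A, Real.cos A] ∧
        (u : Matrix (Fin 2) (Fin 2) ℝ) = !![-1, 0; 0, 1] := by
  have hpi := Real.pi_pos
  have hA := Real.sin_sq_add_cos_sq A
  have hB := Real.sin_sq_add_cos_sq B
  have hsA : 0 < Real.sin A := Real.sin_pos_of_pos_of_lt_pi hA0 (by linarith)
  have hsB : 0 < Real.sin B := Real.sin_pos_of_pos_of_lt_pi hB0 (by linarith)
  have hcA : 0 < Real.cos A := Real.cos_pos_of_mem_Ioo ⟨by linarith, hA1⟩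
  have hcosA : Real.cos (-A) = Real.cos A := Real.cos_neg _
  have hsinA : Real.sin (-A) = -Real.sin A := Real.sin_neg _
  have hcosB : Real.cos (-B) = Real.cos B := Real.cos_neg _
  have hsinB : Real.sin (-B) = -Real.sin B := Real.sin_neg _
  set sA := Real.sin A
  set cA := Real.cos A
  set sB := Real.sin B
  set cB := Real.cos B
  obtain ⟨q, hq⟩ : ∃ q, q = α + τ := ⟨_, rfl⟩
  rw [← hq]
  have hq0 : 0 < q := by rw [hq]; positivity
  have hq1 : q ^ 2 - 1 = 2 * τ * q := by rw [hq]; linear_combination hατ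
  have hq2 : q ^ 2 + 1 = 2 * α * q := by rw [hq]; linear_combination -hατ
  have hq3 : 1 < q := by
    have : 0 < 2 * τ * q := by positivity
    nlinarith
  -- the coordinates of the third vertex
  obtain ⟨x, hx⟩ : ∃ x, x = -(q * (τ * sA) / cA) := ⟨_, rfl⟩
  obtain ⟨y, hy⟩ : ∃ y, y = q * sB / cA := ⟨_, rfl⟩
  have hx' : x * cA = -(q * (τ * sA)) := by rw [hx]; field_simp
  have hy' : y * cA = q * sB := by rw [hy]; field_simp
  have hy0 : 0 < y := by rw [hy]; positivity
  have hx0 : x < 0 := by rw [hx]; exact neg_neg_of_pos (by positivity)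
  have hxy : x ^ 2 + y ^ 2 = q ^ 2 := by
    have h : (x ^ 2 + y ^ 2) * cA ^ 2 = q ^ 2 * cA ^ 2 := by
      calc _ = (x * cA) ^ 2 + (y * cA) ^ 2 := by ring
        _ = _ := by
          rw [hx', hy']
          have e1 : cB ^ 2 = α ^ 2 * sA ^ 2 := by rw [← hαA]; ring
          linear_combination q ^ 2 * hB - q ^ 2 * e1 - q ^ 2 * hA - q ^ 2 * sA ^ 2 * hατ
    exact mul_right_cancel₀ (by positivity) h
  let P : UpperHalfPlane := ⟨Complex.I * q, by simpa using hq0⟩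
  let Q : UpperHalfPlane := ⟨x + y * Complex.I, by simpa using hy0⟩
  let R : UpperHalfPlane := ⟨Complex.I, by simp⟩
  have hP : (P : ℂ) = Complex.I * q := rfl
  have hQ : (Q : ℂ) = x + y * Complex.I := rfl
  have hR : (R : ℂ) = Complex.I := rfl
  have hPQ : P ≠ Q := fun h => by
    have := congrArg (fun z : UpperHalfPlane => (z : ℂ).re) h
    simp [hP, hQ] at this
    exact hx0.ne this.symm
  have hQR : Q ≠ R := fun h => by
    have := congrArg (fun z : UpperHalfPlane => (z : ℂ).re) h
    simp [hR, hQ] at this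
    exact hx0.ne this
  have hRP : R ≠ P := fun h => by
    have := congrArg (fun z : UpperHalfPlane => (z : ℂ).im) h
    simp [hR, hP] at this
    exact hq3.ne this
  have hI := Complex.I_sq
  have hxyC : (x : ℂ) ^ 2 + y ^ 2 = q ^ 2 := by exact_mod_cast hxy
  have hq1C : (q : ℂ) ^ 2 - 1 = 2 * τ * q := by exact_mod_cast hq1
  have hq2C : (q : ℂ) ^ 2 + 1 = 2 * α * q := by exact_mod_cast hq2
  have hxC : (x : ℂ) * cA = -(q * (τ * sA)) := by exact_mod_cast hx'
  have hyC : (y : ℂ) * cA = q * sB := by exact_mod_cast hy'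
  have hαAC : (α : ℂ) * sA = cB := by exact_mod_cast hαA
  have hcAC : (cA : ℂ) ≠ 0 := by exact_mod_cast hcA.ne'
  refine ⟨P, Q, R, hPQ, hQR, hRP, ?_, ?_, ?_, ?_⟩
  · rw [hyperbolicAngle_eq hPQ.symm hRP (θ := -(Real.pi / 2))
      (ρ := 2 * q * -x * (q ^ 2 - 1)) ⟨by linarith, by linarith⟩
      (mul_pos (mul_pos (by linarith) (by linarith)) (by nlinarith)), abs_neg,
      abs_of_pos (by linarith)]
    rw [Real.cos_neg, Real.sin_neg, Real.cos_pi_div_two, Real.sin_pi_div_two, hP, hQ, hR]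
    simp only [map_mul, map_sub, map_add, Complex.conj_I, Complex.conj_ofReal, map_neg]
    push_cast
    linear_combination ((q : ℂ) ^ 2 - 1) * (x ^ 2 - 2 * x * q * Complex.I +
      (q ^ 2 - y ^ 2) * (Complex.I ^ 2 - 1)) * hI - ((q : ℂ) ^ 2 - 1) * hxyC
  · rw [hyperbolicAngle_eq hQR.symm hPQ (θ := -B)
      (ρ := 4 * q ^ 3 * (τ ^ 2 * sA) / cA ^ 2) ⟨by linarith, by linarith⟩
      (by positivity), abs_neg, abs_of_pos hB0]
    rw [hcosB, hsinB, hP, hQ, hR]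
    simp only [map_mul, map_sub, map_add, Complex.conj_I, Complex.conj_ofReal, map_neg]
    push_cast
    have e1 : 4 * (q : ℂ) ^ 3 * (τ ^ 2 * sA) / cA ^ 2 * cB = 4 * α * q * x ^ 2 := by
      rw [← hαAC]
      field_simp
      linear_combination -(α * q * (x * cA - q * (τ * sA))) * hxC
    have e2 : 4 * (q : ℂ) ^ 3 * (τ ^ 2 * sA) / cA ^ 2 * sB = -(4 * τ * q * x * y) := by
      field_simp
      linear_combination q * τ * (y * cA * hxC - q * τ * sA * hyC)
    linear_combination (-(q ^ 2 * (x + y * Complex.I) ^ 2 + (x - y * Complex.I) ^ 2) +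
      (Complex.I ^ 2 - 1) * q ^ 2 - y ^ 2 * (x ^ 2 - y ^ 2 * Complex.I ^ 2 + q ^ 2) +
      (q ^ 2 + 1) * y ^ 2) * hI + (x ^ 2 - y ^ 2 * Complex.I ^ 2 - 1) * hxyC +
      2 * x ^ 2 * hq2C + 2 * x * y * Complex.I * hq1C - e1 + Complex.I * e2
  · rw [hyperbolicAngle_eq hRP.symm hQR (θ := -A)
      (ρ := (q ^ 2 - 1) * (2 * τ * q) / cA) ⟨by linarith, by linarith⟩
      (by have : 0 < q ^ 2 - 1 := by nlinarith
          positivity), abs_neg, abs_of_pos hA0]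
    rw [hcosA, hsinA, hP, hQ, hR]
    simp only [map_mul, map_sub, map_add, Complex.conj_I, Complex.conj_ofReal, map_neg]
    push_cast
    have e1 : ((q : ℂ) ^ 2 - 1) * (2 * τ * q) / cA * cA = (q ^ 2 - 1) * (2 * τ * q) :=
      div_mul_cancel₀ _ hcAC
    have e2 : ((q : ℂ) ^ 2 - 1) * (2 * τ * q) / cA * sA = -((q ^ 2 - 1) * (2 * x)) := by
      field_simp
      linear_combination ((q : ℂ) ^ 2 - 1) * hxC
    linear_combination -((q : ℂ) ^ 2 - 1) * (x ^ 2 + 2 * x * Complex.I +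
      (1 - y ^ 2) * (Complex.I ^ 2 - 1)) * hI + ((q : ℂ) ^ 2 - 1) * (hxyC + hq1C) - e1 +
      Complex.I * e2
  · have hs : (!![0, q ^ 2; 1, 0] : Matrix (Fin 2) (Fin 2) ℝ).det = -q ^ 2 := by
      simp [Matrix.det_fin_two]
    have ht : (!![-cA, sA; sA, cA] : Matrix (Fin 2) (Fin 2) ℝ).det = -1 := by
      rw [Matrix.det_fin_two_of]; linarith
    have hu : (!![-1, 0; 0, 1] : Matrix (Fin 2) (Fin 2) ℝ).det = -1 := by
      simp [Matrix.det_fin_two]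
    have hq20 : 0 < q ^ 2 := by positivity
    let s := Matrix.GeneralLinearGroup.mkOfDetNeZero _ (hs ▸ neg_ne_zero.mpr hq20.ne')
    let t := Matrix.GeneralLinearGroup.mkOfDetNeZero _ (ht ▸ neg_ne_zero.mpr one_ne_zero)
    let u := Matrix.GeneralLinearGroup.mkOfDetNeZero _ (hu ▸ neg_ne_zero.mpr one_ne_zero)
    have hs' : (s : Matrix (Fin 2) (Fin 2) ℝ) = !![0, q ^ 2; 1, 0] := rfl
    have ht' : (t : Matrix (Fin 2) (Fin 2) ℝ) = !![-cA, sA; sA, cA] := rfl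
    have hu' : (u : Matrix (Fin 2) (Fin 2) ℝ) = !![-1, 0; 0, 1] := rfl
    have hsd : s.det.val < 0 := by
      rw [Matrix.GeneralLinearGroup.val_det_apply, hs', hs]; linarith
    have htd : t.det.val < 0 := by
      rw [Matrix.GeneralLinearGroup.val_det_apply, ht', ht]; norm_num
    have hud : u.det.val < 0 := by
      rw [Matrix.GeneralLinearGroup.val_det_apply, hu', hu]; norm_num
    refine ⟨s, t, u, ⟨hsd, smul_eq_self_of_det_neg hsd ?_, smul_eq_self_of_det_neg hsd ?_⟩,
      ⟨htd, smul_eq_self_of_det_neg htd ?_, smul_eq_self_of_det_neg htd ?_⟩,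
      ⟨hud, smul_eq_self_of_det_neg hud ?_, smul_eq_self_of_det_neg hud ?_⟩, hs', ht', hu'⟩
    all_goals
      simp only [hs', ht', hu', hP, hQ, hR, Matrix.of_apply, Matrix.cons_val', Matrix.cons_val_zero,
        Matrix.cons_val_one, Matrix.cons_val_fin_one, map_mul, map_add, Complex.conj_I,
        Complex.conj_ofReal]
      push_cast
    · linear_combination (q : ℂ) ^ 2 * hI
    · linear_combination -hxyC + y ^ 2 * hI
    · linear_combination (-sA : ℂ) * hxyC + sA * y ^ 2 * hI - 2 * hxC - sA * hq1C
    · linear_combination (sA : ℂ) * hI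
    · ring
    · ring

/-! ### Comparison of the unitary group with the triangle group -/

open Matrix.ProjGenLinGroup in
lemma mk_mul_mk_eq_mul {K L R : GL (Fin 2) ℂ} {c : ℂ} (hc : c ≠ 0)
    (h : c • ((K : Matrix (Fin 2) (Fin 2) ℂ) * L) = (L : Matrix (Fin 2) (Fin 2) ℂ) * R) :
    (mk L)⁻¹ * mk K * mk L = mk R := by
  rw [mul_assoc, inv_mul_eq_iff_eq_mul, ← map_mul, ← map_mul, mk_eq_mk_iff]
  refine ⟨Units.mk0 c hc, Units.ext ?_⟩
  rw [Units.val_mul, Units.val_mul, Units.val_mul, ← h]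
  ext i j
  fin_cases i <;> fin_cases j <;> simp [Matrix.mul_apply, Fin.sum_univ_two, mul_comm]

lemma closure_triple_eq {G : Type*} [Group G] {x y z : G} (h : x * y * z = 1) :
    Subgroup.closure {x, y, z} = Subgroup.closure {y, z} := by
  apply le_antisymm
  · rw [Subgroup.closure_le]
    have hy : y ∈ Subgroup.closure {y, z} := Subgroup.subset_closure (by simp)
    have hz : z ∈ Subgroup.closure {y, z} := Subgroup.subset_closure (by simp)
    rintro g (rfl | rfl | rfl)
    · rw [mul_assoc] at h
      rw [eq_inv_of_mul_eq_one_left h]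
      exact inv_mem (mul_mem hy hz)
    · exact hy
    · exact hz
  · exact Subgroup.closure_mono (by simp)

open Matrix.ProjGenLinGroup in
/-- The rotation `diag(1, ζ)` and the half-turn `N` generate a triangle group: the coordinate of the
upper half plane with centre `i` identifies them with products of reflections in the sides of a
triangle. In this coordinate the disc is scaled by `√w` and turned by `κ`. -/
lemma isSchwarzTriangleGroup_closure {m b : ℕ} (hm : 3 ≤ m) (hb : 3 ≤ b) {w r : ℝ}
    (hw : 0 < w) (hr : 0 < r) {a κ : ℂ} (hκ : κ ≠ 0) (haκ : a = κ * ‖a‖)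
    (ha : ‖a‖ * Real.sin (Real.pi / m) = Real.cos (Real.pi / b))
    (har : ‖a‖ ^ 2 - w * r ^ 2 = 1) {R N : GL (Fin 2) ℂ}
    (hR : (R : Matrix (Fin 2) (Fin 2) ℂ) = !![1, 0; 0, zeta m])
    (hN : (N : Matrix (Fin 2) (Fin 2) ℂ) = !![a, κ ^ 2 * w * r; -r, -a]) :
    IsSchwarzTriangleGroup 2 b m (Subgroup.closure {mk R, mk N}) := by
  have hpi := Real.pi_pos
  have hlt : ∀ n : ℕ, 3 ≤ n → Real.pi / n < Real.pi / 2 := fun n hn => by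
    have : (3 : ℝ) ≤ n := by exact_mod_cast hn
    gcongr
    linarith
  have hpos : ∀ n : ℕ, 3 ≤ n → 0 < Real.pi / n := fun n hn => by
    have : (3 : ℝ) ≤ n := by exact_mod_cast hn
    positivity
  have hcB : 0 < Real.cos (Real.pi / b) :=
    Real.cos_pos_of_mem_Ioo ⟨by linarith [hpos b hb], hlt b hb⟩
  have hsA : 0 < Real.sin (Real.pi / m) :=
    Real.sin_pos_of_pos_of_lt_pi (hpos m hm) (by linarith [hlt m hm])
  have hα0 : 0 < ‖a‖ := pos_of_mul_pos_left (by rw [ha]; exact hcB) hsA.le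
  have hsw : 0 < √w := Real.sqrt_pos.mpr hw
  have hww : √w ^ 2 = w := Real.sq_sqrt hw.le
  have hE : zeta m = (Real.cos (Real.pi / m) + Real.sin (Real.pi / m) * Complex.I) ^ 2 := by
    have h := zeta_pow_eq m 1
    rw [pow_one] at h
    rw [h, Complex.ofReal_cos, Complex.ofReal_sin, ← Complex.exp_mul_I, ← Complex.exp_nat_mul]
    congr 1
    push_cast
    ring
  have hατ : ‖a‖ ^ 2 - (√w * r) ^ 2 = 1 := by rw [mul_pow, hww, har]
  obtain ⟨P, Q, R', hPQ, hQR, hRP, hP, hQ, hR', s, t, u, hs, ht, hu, hsv, htv, huv⟩ :=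
    exists_triangle (hpos m hm) (hlt m hm) (hpos b hb) (hlt b hb) hα0 (mul_pos hsw hr) ha hατ
  have hA := Real.sin_sq_add_cos_sq (Real.pi / m)
  set q : ℝ := ‖a‖ + √w * r with hq
  have hq0 : 0 < q := by positivity
  -- the columns are the eigenvectors `(i, 1)` and `(-i, 1)` of the rotations about `i`, rescaled
  have hdet : (!![Complex.I, -Complex.I * (√w * κ); 1, √w * κ] :
      Matrix (Fin 2) (Fin 2) ℂ).det ≠ 0 := by
    rw [Matrix.det_fin_two_of]
    have h1 : (√w : ℂ) ≠ 0 := by exact_mod_cast hsw.ne'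
    have h2 : Complex.I * (√w * κ) - -Complex.I * (√w * κ) * 1 = 2 * Complex.I * √w * κ := by ring
    rw [h2]
    exact mul_ne_zero (mul_ne_zero (mul_ne_zero two_ne_zero Complex.I_ne_zero) h1) hκ
  let L := Matrix.GeneralLinearGroup.mkOfDetNeZero _ hdet
  have hL : (L : Matrix (Fin 2) (Fin 2) ℂ) = !![Complex.I, -Complex.I * (√w * κ); 1, √w * κ] := rfl
  have hmap : ∀ g : GL (Fin 2) ℝ, ((Matrix.GeneralLinearGroup.map Complex.ofRealHom g :
      GL (Fin 2) ℂ) : Matrix (Fin 2) (Fin 2) ℂ) =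
      (g : Matrix (Fin 2) (Fin 2) ℝ).map Complex.ofRealHom := fun g => rfl
  have hI := Complex.I_sq
  have hAC : (Real.sin (Real.pi / m) : ℂ) ^ 2 + (Real.cos (Real.pi / m) : ℂ) ^ 2 = 1 := by
    exact_mod_cast hA
  have htu : (mk L)⁻¹ * realToPGL (t * u) * mk L = mk R := by
    refine mk_mul_mk_eq_mul (c := Real.cos (Real.pi / m) + Real.sin (Real.pi / m) * Complex.I) ?_ ?_
    · intro h0
      have := norm_zeta m
      rw [hE, h0] at this
      norm_num at this
    · rw [hmap, Units.val_mul, htv, huv, hL, hR, hE]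
      set cA := Real.cos (Real.pi / m)
      set sA := Real.sin (Real.pi / m)
      ext i j
      fin_cases i <;> fin_cases j <;> simp [Matrix.mul_apply, Fin.sum_univ_two]
      · linear_combination Complex.I * hAC + cA * sA * hI
      · linear_combination √w * κ * (cA + sA * Complex.I) * sA * hI
      · linear_combination hAC - (sA : ℂ) ^ 2 * hI
      · ring
  have hus : (mk L)⁻¹ * realToPGL (u * s) * mk L = mk N := by
    have hqC : (q : ℂ) ≠ 0 := by exact_mod_cast hq0.ne'
    have hqC' : (q : ℂ) * (‖a‖ - √w * r) = 1 := by
      rw [hq]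
      push_cast
      have : (‖a‖ : ℂ) ^ 2 - (√w * r) ^ 2 = 1 := by exact_mod_cast hατ
      linear_combination this
    have hinv : (q : ℂ)⁻¹ = ‖a‖ - √w * r := inv_eq_of_mul_eq_one_right hqC'
    have hwC : (√w : ℂ) ^ 2 = w := by exact_mod_cast hww
    have hqe : (q : ℂ) = ‖a‖ + √w * r := by rw [hq]; push_cast; rfl
    refine mk_mul_mk_eq_mul (c := -Complex.I * κ * (q : ℂ)⁻¹) ?_ ?_
    · exact mul_ne_zero (mul_ne_zero (neg_ne_zero.mpr Complex.I_ne_zero) hκ) (inv_ne_zero hqC)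
    · have haC : a = κ * (‖a‖ : ℂ) := haκ
      rw [hmap, Units.val_mul, hsv, huv, hL, hN, hinv]
      generalize (‖a‖ : ℂ) = α at *
      rw [haC, ← hwC]
      ext i j
      fin_cases i <;> fin_cases j <;> simp [Matrix.mul_apply, Fin.sum_univ_two]
      · linear_combination Complex.I * κ * q * hqC' + Complex.I * κ * hqe
      · linear_combination Complex.I * κ ^ 2 * √w * (q * hqC' + hqe)
      · linear_combination -κ * (α - √w * r) * hI
      · linear_combination κ ^ 2 * √w * (α - √w * r) * hI
  -- `(st)(tu)(us)` is scalar, so that `st` is redundant as a generator of the projective group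
  have hst : realToPGL (s * t) * realToPGL (t * u) * realToPGL (u * s) = 1 := by
    have h1 : s * t * (t * u) * (u * s) =
        .scalar (Fin 2) (Units.mk0 (q ^ 2) (by positivity)) := by
      apply Units.ext
      have h2 : (t * t : Matrix (Fin 2) (Fin 2) ℝ) = 1 := by
        rw [htv, Matrix.one_fin_two]
        ext i j
        fin_cases i <;> fin_cases j <;> simp [Matrix.mul_apply, Fin.sum_univ_two]
        all_goals nlinarith
      have h3 : (u * u : Matrix (Fin 2) (Fin 2) ℝ) = 1 := by
        rw [huv, Matrix.one_fin_two]
        ext i j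
        fin_cases i <;> fin_cases j <;> simp [Matrix.mul_apply, Fin.sum_univ_two]
      have h4 : ((s * t * (t * u) * (u * s) : GL (Fin 2) ℝ) : Matrix (Fin 2) (Fin 2) ℝ) =
          s * (t * t) * (u * u) * s := by
        simp only [Units.val_mul, mul_assoc]
      rw [h4, h2, h3, mul_one, mul_one, hsv]
      ext i j
      fin_cases i <;> fin_cases j <;> simp [Matrix.mul_apply, Fin.sum_univ_two]
    rw [← map_mul, ← map_mul, h1, realToPGL, MonoidHom.comp_apply]
    have h5 : Matrix.GeneralLinearGroup.map Complex.ofRealHom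
        (.scalar (Fin 2) (Units.mk0 (q ^ 2) (by positivity))) =
        .scalar (Fin 2) (Units.mk0 ((q : ℂ) ^ 2) (by
          have : (q : ℂ) ≠ 0 := by exact_mod_cast hq0.ne'
          positivity)) := by
      ext i j
      fin_cases i <;> fin_cases j <;> simp
    rw [h5, mk_scalar]
  refine ⟨le_rfl, by omega, by omega, P, Q, R', hPQ, hQR, hRP, by simpa using hP, hQ, hR', s, t, u,
    hs, ht, hu, (mk L)⁻¹, ?_⟩
  have hconj : ∀ g : PGL(2, ℂ), (MulAut.conj (mk L)⁻¹).toMonoidHom g = (mk L)⁻¹ * g * mk L :=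
    fun g => by simp
  rw [MonoidHom.map_closure, MonoidHom.map_closure]
  simp only [Set.image_insert_eq, Set.image_singleton]
  rw [closure_triple_eq (by rw [← map_mul, ← map_mul, hst, map_one]), hconj, hconj, htu, hus]

open Matrix.ProjGenLinGroup in
/-- The criterion behind all five cases. The half-turn `N` of `Γ` moves the centre by twice the
distance `d` with `cosh d = ‖a‖`, which is the length of the side between the vertices with angles
`π / 2` and `π / m`; and no element of `Γ` moves the centre into the rest of the polygon formed by
the triangles around it. -/
lemma isSchwarzTriangleGroup_projGam {m b : ℕ} (hm : 3 ≤ m) (hm2 : 2 ∣ m) (hb : 3 ≤ b) {w r δ : ℝ}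
    (hw : 0 < w) (hr : 0 < r) (hδ0 : 0 < δ) {a : ℂ} {k : ℕ} (hak : a = zeta m ^ k * conj a)
    (ha : ‖a‖ * Real.sin (Real.pi / m) = Real.cos (Real.pi / b))
    (har : ‖a‖ ^ 2 - w * r ^ 2 = 1) (ham : a ∈ cyclotomicIntegers m)
    (hrm : (r : ℂ) ∈ cyclotomicIntegers m) (hwrm : ((w * r : ℝ) : ℂ) ∈ cyclotomicIntegers m)
    (hδ : Real.cos (Real.pi / m) * Real.cos (Real.pi / b) <
      (2 * δ + 1) * (Real.sin (Real.pi / m) * Real.sin (Real.pi / b)))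
    (hmin : ∀ A ∈ Gam m w, toGLComplex m A 1 0 ≠ 0 → δ ≤ w * ‖toGLComplex m A 1 0‖ ^ 2) :
    IsSchwarzTriangleGroup 2 b m (projGam m w) := by
  have hm0 : m ≠ 0 := by omega
  have hbr : (3 : ℝ) ≤ b := by exact_mod_cast hb
  have hpi := Real.pi_pos
  have ha0 : a ≠ 0 := by
    rintro rfl
    have : 0 < w * r ^ 2 := by positivity
    norm_num at har
    linarith
  have hαC : (‖a‖ : ℂ) ≠ 0 := by exact_mod_cast norm_ne_zero_iff.mpr ha0
  obtain ⟨κ, hκdef⟩ : ∃ κ : ℂ, κ = a / ‖a‖ := ⟨_, rfl⟩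
  have haκ : a = κ * ‖a‖ := by rw [hκdef]; field_simp
  have hκ0 : κ ≠ 0 := by rw [hκdef]; exact div_ne_zero ha0 hαC
  have hκ : κ ^ 2 = zeta m ^ k := by
    have h1 : a * conj a = ‖a‖ ^ 2 := Complex.mul_conj' a
    have h2 : a ^ 2 = zeta m ^ k * ‖a‖ ^ 2 := by
      rw [← h1]
      linear_combination a * hak
    rw [hκdef, div_pow, h2]
    field_simp
  have hzk : zeta m ^ k * conj (zeta m ^ k) = 1 := by
    rw [Complex.mul_conj', norm_pow, norm_zeta]; simp
  have hzk' : zeta m ^ k * conj (zeta m) ^ k = 1 := by rw [← map_pow, hzk]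
  have hzn : ∀ n : ℕ, zeta m ^ n ∈ cyclotomicIntegers m := fun n => pow_mem (zeta_mem m) n
  have hzc : ∀ n : ℕ, conj (zeta m ^ n) ∈ cyclotomicIntegers m := fun n => by
    rw [map_pow]; exact pow_mem (conj_zeta_mem m hm0) n
  have hz1 : zeta m * conj (zeta m) = 1 := by rw [Complex.mul_conj', norm_zeta]; simp
  obtain ⟨R, hRG, hR⟩ : ∃ A ∈ Gam m w, (toGLComplex m A : Matrix (Fin 2) (Fin 2) ℂ) =
      !![1, 0; 0, zeta m] := by
    refine exists_mem_Gam ?_ (conj_zeta_mem m hm0) (by simpa [Matrix.det_fin_two] using hz1) ?_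
    · intro i j
      fin_cases i <;> fin_cases j
      exacts [one_mem _, zero_mem _, zero_mem _, zeta_mem m]
    · ext i j
      fin_cases i <;> fin_cases j <;>
        simp [hermitianForm, Matrix.mul_apply, Fin.sum_univ_two]
      linear_combination (-w : ℂ) * hz1
  have harC : (‖a‖ : ℂ) ^ 2 - w * r ^ 2 = 1 := by exact_mod_cast har
  have haa : a * conj a = ‖a‖ ^ 2 := Complex.mul_conj' a
  obtain ⟨N, hNG, hN⟩ : ∃ A ∈ Gam m w, (toGLComplex m A : Matrix (Fin 2) (Fin 2) ℂ) =
      !![a, κ ^ 2 * w * r; -r, -a] := by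
    rw [hκ]
    refine exists_mem_Gam ?_ (neg_mem (hzc k)) ?_ ?_
    · intro i j
      fin_cases i <;> fin_cases j
      · exact ham
      · have := mul_mem (hzn k) hwrm
        rw [Complex.ofReal_mul, ← mul_assoc] at this
        exact this
      · exact neg_mem hrm
      · exact neg_mem ham
    · rw [Matrix.det_fin_two_of]
      linear_combination conj (zeta m ^ k) * a * hak +
        zeta m ^ k * conj (zeta m ^ k) * (haa + harC) + hzk
    · ext i j
      fin_cases i <;> fin_cases j <;>
        simp [hermitianForm, Matrix.mul_apply, Fin.sum_univ_two]
      · linear_combination haa + harC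
      · linear_combination (w * r : ℂ) * (conj (zeta m) ^ k * hak + conj a * hzk')
      · linear_combination (-(w * r) : ℂ) * hak
      · linear_combination (w ^ 2 * r ^ 2 : ℂ) * hzk' - w * haa - w * harC
  have heq : projGam m w = Subgroup.closure {mk (toGLComplex m R), mk (toGLComplex m N)} := by
    apply le_antisymm
    · rintro _ ⟨A, hA, rfl⟩
      have hv : ‖κ ^ 2‖ = 1 := by rw [hκ, norm_pow, norm_zeta, one_pow]
      have hB0 : 0 < Real.pi / b := by positivity
      have hB1 : Real.pi / b ≤ Real.pi / 2 := by gcongr; linarith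
      exact mk_mem_of_mem_Gam (by omega) hm2 hw hr hv hB0 hB1 ha har hδ0 hδ hmin hRG hNG hR hN
        (Subgroup.subset_closure (by simp)) (Subgroup.subset_closure (by simp)) hA
    · rw [Subgroup.closure_le]
      rintro _ (rfl | rfl)
      exacts [⟨R, hRG, rfl⟩, ⟨N, hNG, rfl⟩]
  rw [heq]
  exact isSchwarzTriangleGroup_closure hm hb hw hr hκ0 haκ ha har hR hN

section

open Polynomial

/-! ### Relations between the real numbers `2 cos (2 π j / m)` -/

lemma realP_two_mul (m j : ℕ) : realP m (2 * j) = realP m j ^ 2 - 2 := by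
  rw [realP, realP, show 2 * Real.pi * ((2 * j : ℕ) : ℝ) / m = 2 * (2 * Real.pi * j / m) by
    push_cast; ring, Real.cos_two_mul]
  ring

lemma realP_three_mul (m j : ℕ) : realP m (3 * j) = realP m j ^ 3 - 3 * realP m j := by
  rw [realP, realP, show 2 * Real.pi * ((3 * j : ℕ) : ℝ) / m = 3 * (2 * Real.pi * j / m) by
    push_cast; ring, Real.cos_three_mul]
  ring

lemma realP_eq_neg_of_add_eq {n j k : ℕ} (hn : n ≠ 0) (h : j + k = n) :
    realP (2 * n) j = -realP (2 * n) k := by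
  have hn' : (n : ℝ) ≠ 0 := Nat.cast_ne_zero.mpr hn
  have hj : (j : ℝ) = n - k := by rw [← h]; push_cast; ring
  rw [realP, realP, show 2 * Real.pi * (j : ℝ) / ((2 * n : ℕ) : ℝ) =
    Real.pi - 2 * Real.pi * k / ((2 * n : ℕ) : ℝ) by
      rw [hj]; push_cast; field_simp, Real.cos_pi_sub]
  ring

lemma sin_sq_pi_div (m : ℕ) : Real.sin (Real.pi / m) ^ 2 = (2 - realP m 1) / 4 := by
  rw [realP, show 2 * Real.pi * ((1 : ℕ) : ℝ) / m = 2 * (Real.pi / m) by push_cast; ring,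
    Real.cos_two_mul, Real.sin_sq]
  ring

lemma cos_sq_pi_div (m : ℕ) : Real.cos (Real.pi / m) ^ 2 = (2 + realP m 1) / 4 := by
  rw [realP, show 2 * Real.pi * ((1 : ℕ) : ℝ) / m = 2 * (Real.pi / m) by push_cast; ring,
    Real.cos_two_mul]
  ring

lemma sqrt_three_le_realP {m : ℕ} (hm : 12 ≤ m) : √3 ≤ realP m 1 := by
  have hmr : (12 : ℝ) ≤ m := by exact_mod_cast hm
  have hpi := Real.pi_pos
  have h1 : 2 * Real.pi * ((1 : ℕ) : ℝ) / m ≤ Real.pi / 6 := by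
    rw [div_le_div_iff₀ (by linarith) (by norm_num)]
    push_cast
    nlinarith
  have h := Real.cos_le_cos_of_nonneg_of_le_pi (by positivity) (by linarith) h1
  rw [Real.cos_pi_div_six] at h
  rw [realP]
  linarith

lemma norm_one_add_zeta_pow_sq (m j : ℕ) : ‖1 + zeta m ^ j‖ ^ 2 = 2 + realP m j := by
  rw [Complex.sq_norm, Complex.normSq_add, one_mul, Complex.conj_re, re_zeta_pow,
    Complex.normSq_eq_norm_sq (zeta m ^ j), norm_pow, norm_zeta, realP]
  simp
  ring

lemma sin_pi_div_pos {m : ℕ} (hm : 2 ≤ m) : 0 < Real.sin (Real.pi / m) := by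
  have hmr : (2 : ℝ) ≤ m := by exact_mod_cast hm
  exact Real.sin_pos_of_pos_of_lt_pi (by positivity)
    (div_lt_self Real.pi_pos (by linarith))

lemma cos_pi_div_nonneg {m : ℕ} (hm : 2 ≤ m) : 0 ≤ Real.cos (Real.pi / m) := by
  have hmr : (2 : ℝ) ≤ m := by exact_mod_cast hm
  refine Real.cos_nonneg_of_neg_pi_div_two_le_of_le ?_ ?_
  · have : 0 < Real.pi / m := by positivity
    linarith [Real.pi_pos]
  · gcongr

lemma map_quadratic_eq {x y : ℝ} {s t : ℤ} (hs : x + y = s) (ht : x * y = t) :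
    (X ^ 2 - C s * X + C t : ℤ[X]).map (Int.castRingHom ℝ) = (X - C x) * (X - C y) := by
  simp only [Polynomial.map_add, Polynomial.map_sub, Polynomial.map_mul, Polynomial.map_pow,
    map_X, map_C, eq_intCast (Int.castRingHom ℝ)]
  rw [← hs, ← ht, C_add, C_mul]
  ring

lemma map_cubic_eq {x y z : ℝ} {s t u : ℤ} (hs : x + y + z = s) (ht : x * y + x * z + y * z = t)
    (hu : x * y * z = u) : (X ^ 3 - C s * X ^ 2 + C t * X - C u : ℤ[X]).map (Int.castRingHom ℝ) =
      (X - C x) * ((X - C y) * (X - C z)) := by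
  simp only [Polynomial.map_add, Polynomial.map_sub, Polynomial.map_mul, Polynomial.map_pow,
    map_X, map_C, eq_intCast (Int.castRingHom ℝ)]
  rw [← hs, ← ht, ← hu]
  simp only [C_add, C_mul]
  ring

/-! ### The criteria in terms of `2 cos (2 π / m)` -/

/-- The criterion for the types `(2, m, m)`. -/
lemma isSchwarzTriangleGroup_two_self {m : ℕ} (hm : 3 ≤ m) (hm2 : 2 ∣ m) {w r δ : ℝ}
    (hw : 0 < w) (hr : 0 < r) (hδ0 : 0 < δ) {a : ℂ} {k : ℕ} (hak : a = zeta m ^ k * conj a)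
    (ha : ‖a‖ ^ 2 * (2 - realP m 1) = 2 + realP m 1)
    (har : ‖a‖ ^ 2 - w * r ^ 2 = 1) (ham : a ∈ cyclotomicIntegers m)
    (hrm : (r : ℂ) ∈ cyclotomicIntegers m) (hwrm : ((w * r : ℝ) : ℂ) ∈ cyclotomicIntegers m)
    (hδ : 2 + realP m 1 < (2 * δ + 1) * (2 - realP m 1))
    (hmin : ∀ A ∈ Gam m w, toGLComplex m A 1 0 ≠ 0 → δ ≤ w * ‖toGLComplex m A 1 0‖ ^ 2) :
    IsSchwarzTriangleGroup 2 m m (projGam m w) := by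
  have hs := sin_sq_pi_div m
  have hc := cos_sq_pi_div m
  refine isSchwarzTriangleGroup_projGam hm hm2 hm hw hr hδ0 hak ?_ har ham hrm hwrm ?_ hmin
  · have h1 := sin_pi_div_pos (by omega : 2 ≤ m)
    refine (pow_left_inj₀ (by positivity) (cos_pi_div_nonneg (by omega)) two_ne_zero).mp ?_
    rw [mul_pow, hs, hc]
    linarith
  · rw [← sq, ← sq, hs, hc]
    linarith

/-- The criterion for the types `(2, 3, m)`. -/
lemma isSchwarzTriangleGroup_two_three {m : ℕ} (hm : 3 ≤ m) (hm2 : 2 ∣ m) {w r δ : ℝ}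
    (hw : 0 < w) (hr : 0 < r) (hδ0 : 0 < δ) {a : ℂ} {k : ℕ} (hak : a = zeta m ^ k * conj a)
    (ha : ‖a‖ ^ 2 * (2 - realP m 1) = 1)
    (har : ‖a‖ ^ 2 - w * r ^ 2 = 1) (ham : a ∈ cyclotomicIntegers m)
    (hrm : (r : ℂ) ∈ cyclotomicIntegers m) (hwrm : ((w * r : ℝ) : ℂ) ∈ cyclotomicIntegers m)
    (hδ : 2 + realP m 1 < 3 * (2 * δ + 1) ^ 2 * (2 - realP m 1))
    (hmin : ∀ A ∈ Gam m w, toGLComplex m A 1 0 ≠ 0 → δ ≤ w * ‖toGLComplex m A 1 0‖ ^ 2) :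
    IsSchwarzTriangleGroup 2 3 m (projGam m w) := by
  have hs := sin_sq_pi_div m
  have hc := cos_sq_pi_div m
  have h1 := sin_pi_div_pos (by omega : 2 ≤ m)
  have h3 : √3 ^ 2 = (3 : ℝ) := Real.sq_sqrt (by norm_num)
  refine isSchwarzTriangleGroup_projGam hm hm2 le_rfl hw hr hδ0 hak ?_ har ham hrm hwrm ?_ hmin
  · rw [Nat.cast_ofNat, Real.cos_pi_div_three]
    refine (pow_left_inj₀ (by positivity) (by norm_num) two_ne_zero).mp ?_
    rw [mul_pow, hs]
    linarith
  · rw [Nat.cast_ofNat, Real.cos_pi_div_three, Real.sin_pi_div_three]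
    refine lt_of_pow_lt_pow_left₀ 2 (by positivity) ?_
    rw [mul_pow, mul_pow, mul_pow, div_pow, div_pow, hs, hc, h3]
    linarith

/-- Lower bound for `w ‖c‖ ^ 2` in `Γ` by the norm of `w`. -/
lemma le_mul_norm_sq_of_mem_Gam {m : ℕ} (hm : m ≠ 0) {J : Finset ℕ}
    (hJ : ∀ j ∈ insert 1 J, j.Coprime m) (hJ1 : 1 ∉ J) {f : ℤ[X]}
    (hf : f.map (Int.castRingHom ℝ) = ∏ j ∈ insert 1 J, (X - C (realP m j))) (W : ℤ[X]) {w δ : ℝ}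
    (hw : 0 < w) (hwW : aeval (realP m 1) W = w) (hW : ∀ j ∈ J, aeval (realP m j) W ≤ 0)
    (hδ : δ = w * ∏ j ∈ J, -aeval (realP m j) W) {A : GL (Fin 2) (cyclotomicIntegers m)}
    (hA : A ∈ Gam m w) (hc : toGLComplex m A 1 0 ≠ 0) : δ ≤ w * ‖toGLComplex m A 1 0‖ ^ 2 := by
  obtain ⟨h00, -⟩ := entries_of_mem_unitaryGroup hw (show toGLComplex m A ∈ _ from hA)
  have h := norm_le_mul_norm_sq hm hJ hJ1 hf W (hwW ▸ hw.le) hW (a := toGLComplex m A 0 0)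
    (A 0 0).2 (A 1 0).2 hc (by rw [hwW]; exact h00)
  rwa [hwW, ← hδ] at h

/-! ### The two groups for `m = 12` -/

lemma realP_twelve_one : realP 12 1 = √3 := by
  rw [realP, show 2 * Real.pi * ((1 : ℕ) : ℝ) / (12 : ℕ) = Real.pi / 6 by push_cast; ring,
    Real.cos_pi_div_six]
  ring

lemma realP_twelve_five : realP 12 5 = -√3 := by
  rw [realP_eq_neg_of_add_eq (n := 6) (k := 1) (by norm_num) (by norm_num), realP_twelve_one]

lemma map_eq_prod_twelve : (X ^ 2 - C 0 * X + C (-3) : ℤ[X]).map (Int.castRingHom ℝ) =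
    ∏ j ∈ insert 1 {5}, (X - C (realP 12 j)) := by
  rw [Finset.prod_insert (by norm_num), Finset.prod_singleton, realP_twelve_one, realP_twelve_five]
  refine map_quadratic_eq (by simp) ?_
  rw [mul_neg, Real.mul_self_sqrt (by norm_num)]
  norm_num

lemma isSchwarzTriangleGroup_two_twelve_twelve :
    IsSchwarzTriangleGroup 2 12 12 (projGam 12 (2 * p 12 1 * (p 12 1 + 2))) := by
  have h3 : √3 ^ 2 = (3 : ℝ) := Real.sq_sqrt (by norm_num)
  have h30 : 0 < √3 := by positivity
  have h31 : (1.7 : ℝ) < √3 := by rw [Real.lt_sqrt] <;> norm_num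
  have h32 : √3 < (1.8 : ℝ) := by rw [Real.sqrt_lt'] <;> norm_num
  have hw : 2 * p 12 1 * (p 12 1 + 2) = ((2 * √3 * (√3 + 2) : ℝ) : ℂ) := by
    rw [p_eq_realP, realP_twelve_one]; push_cast; ring
  have hp : ((√3 : ℝ) : ℂ) ∈ cyclotomicIntegers 12 := by
    have := p_mem 12 1 (by norm_num)
    rwa [p_eq_realP, realP_twelve_one] at this
  have ha : ‖((√3 + 2 : ℝ) : ℂ)‖ = √3 + 2 := by
    rw [Complex.norm_real, Real.norm_eq_abs, abs_of_pos (by positivity)]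
  have h2 : (2 : ℂ) ∈ cyclotomicIntegers 12 := by
    exact_mod_cast natCast_mem (cyclotomicIntegers 12) 2
  rw [hw]
  refine isSchwarzTriangleGroup_two_self (r := 1) (δ := 12) (k := 0) (a := (√3 + 2 : ℝ))
    (by norm_num) (by norm_num) (by positivity) one_pos (by norm_num) ?_ ?_ ?_ ?_ ?_ ?_ ?_ ?_
  · rw [Complex.conj_ofReal, pow_zero, one_mul]
  · rw [ha, realP_twelve_one]
    linear_combination (-√3 - 2) * h3
  · rw [ha]
    linear_combination -h3
  · push_cast
    exact add_mem hp h2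
  · rw [Complex.ofReal_one]; exact one_mem _
  · push_cast
    exact mul_mem (mul_mem (mul_mem h2 hp) (add_mem hp h2)) (one_mem _)
  · rw [realP_twelve_one]
    linarith
  · intro A hA hc
    refine le_mul_norm_sq_of_mem_Gam (J := {5}) (by norm_num) (by decide) (by decide)
      map_eq_prod_twelve (2 * X * (X + 2)) (by positivity) ?_ ?_ ?_ hA hc
    · rw [map_mul, map_mul, map_add, aeval_X, map_ofNat, realP_twelve_one]
    · simp only [Finset.mem_singleton, forall_eq, map_mul, map_add, aeval_X, map_ofNat,
        realP_twelve_five]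
      nlinarith
    · simp only [Finset.prod_singleton, map_mul, map_add, aeval_X, map_ofNat, realP_twelve_five]
      linear_combination (4 * √3 ^ 2 - 4) * h3

lemma isSchwarzTriangleGroup_two_three_twelve :
    IsSchwarzTriangleGroup 2 3 12 (projGam 12 (p 12 1 + 1)⁻¹) := by
  have h3 : √3 ^ 2 = (3 : ℝ) := Real.sq_sqrt (by norm_num)
  have h30 : 0 < √3 := by positivity
  have h31 : (1.7 : ℝ) < √3 := by rw [Real.lt_sqrt] <;> norm_num
  have h32 : √3 < (1.8 : ℝ) := by rw [Real.sqrt_lt'] <;> norm_num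
  have hw : (p 12 1 + 1)⁻¹ = (((√3 + 1)⁻¹ : ℝ) : ℂ) := by
    rw [p_eq_realP, realP_twelve_one]; push_cast; ring
  have hw0 : (0 : ℝ) < (√3 + 1)⁻¹ := by positivity
  have hp : ((√3 : ℝ) : ℂ) ∈ cyclotomicIntegers 12 := by
    have := p_mem 12 1 (by norm_num)
    rwa [p_eq_realP, realP_twelve_one] at this
  have ha : ‖1 + zeta 12‖ ^ 2 = 2 + √3 := by
    have := norm_one_add_zeta_pow_sq 12 1
    rwa [pow_one, realP_twelve_one] at this
  have hz : zeta 12 * conj (zeta 12) = 1 := by rw [Complex.mul_conj', norm_zeta]; simp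
  rw [hw]
  refine isSchwarzTriangleGroup_two_three (r := √3 + 1) (δ := 2) (k := 1) (a := 1 + zeta 12)
    (by norm_num) (by norm_num) hw0 (by positivity) (by norm_num) ?_ ?_ ?_ ?_ ?_ ?_ ?_ ?_
  · rw [map_add, map_one, pow_one]
    linear_combination -hz
  · rw [ha, realP_twelve_one]
    linear_combination -h3
  · rw [ha]
    field_simp
    ring
  · exact add_mem (one_mem _) (zeta_mem 12)
  · push_cast
    exact add_mem hp (one_mem _)
  · rw [inv_mul_cancel₀ (by positivity), Complex.ofReal_one]; exact one_mem _
  · rw [realP_twelve_one]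
    linarith
  · intro A hA hc
    obtain ⟨h00, -, -, hb⟩ :=
      entries_of_mem_unitaryGroup hw0 (show toGLComplex 12 A ∈ _ from hA)
    -- since `w⁻¹` is an integer, it is the entry `b` with `‖b‖ = w ‖c‖` that has to be used here
    have hbc : (√3 + 1)⁻¹ * ‖toGLComplex 12 A 1 0‖ ^ 2 =
        (√3 + 1) * ‖toGLComplex 12 A 0 1‖ ^ 2 := by
      rw [hb]
      field_simp
    have hb0 : toGLComplex 12 A 0 1 ≠ 0 := by
      rw [← norm_ne_zero_iff, hb]
      exact mul_ne_zero hw0.ne' (norm_ne_zero_iff.mpr hc)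
    have hW : aeval (realP 12 1) (X + 1 : ℤ[X]) = √3 + 1 := by simp [realP_twelve_one]
    have h := norm_le_mul_norm_sq (m := 12) (J := {5}) (by norm_num) (by decide) (by decide)
      map_eq_prod_twelve (X + 1) (by rw [hW]; positivity)
      (by simp [realP_twelve_five]) (a := toGLComplex 12 A 0 0)
      (A 0 0).2 (c := toGLComplex 12 A 0 1) (A 0 1).2 hb0 (by rw [hW, ← hbc]; exact h00)
    rw [hbc]
    refine le_trans (le_of_eq ?_) (h.trans_eq (by rw [hW]))
    rw [hW]
    simp [realP_twelve_five]
    linear_combination -h3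

/-! ### The group for `m = 10` -/

lemma realP_ten_one : realP 10 1 = (1 + √5) / 2 := by
  rw [realP, show 2 * Real.pi * ((1 : ℕ) : ℝ) / (10 : ℕ) = Real.pi / 5 by push_cast; ring,
    Real.cos_pi_div_five]
  ring

lemma realP_ten_one_sq : realP 10 1 ^ 2 = realP 10 1 + 1 := by
  have h5 : √5 ^ 2 = (5 : ℝ) := Real.sq_sqrt (by norm_num)
  rw [realP_ten_one]
  linear_combination h5 / 4

lemma realP_ten_three : realP 10 3 = 1 - realP 10 1 := by
  rw [realP_eq_neg_of_add_eq (n := 5) (k := 2 * 1) (by norm_num) (by norm_num), realP_two_mul]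
  linear_combination -realP_ten_one_sq

lemma map_eq_prod_ten : (X ^ 2 - C 1 * X + C (-1) : ℤ[X]).map (Int.castRingHom ℝ) =
    ∏ j ∈ insert 1 {3}, (X - C (realP 10 j)) := by
  rw [Finset.prod_insert (by norm_num), Finset.prod_singleton, realP_ten_three]
  refine map_quadratic_eq (by push_cast; ring) ?_
  push_cast
  linear_combination -realP_ten_one_sq

lemma isSchwarzTriangleGroup_two_ten_ten :
    IsSchwarzTriangleGroup 2 10 10 (projGam 10 (2 * p 10 1 ^ 3)) := by
  have hw : 2 * p 10 1 ^ 3 = ((2 * realP 10 1 ^ 3 : ℝ) : ℂ) := by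
    rw [p_eq_realP]; push_cast; ring
  have hp : ((realP 10 1 : ℝ) : ℂ) ∈ cyclotomicIntegers 10 := by
    have := p_mem 10 1 (by norm_num)
    rwa [p_eq_realP] at this
  have h2 : (2 : ℂ) ∈ cyclotomicIntegers 10 := by
    exact_mod_cast natCast_mem (cyclotomicIntegers 10) 2
  have hη := realP_ten_one_sq
  have hη1 : 1.5 < realP 10 1 := by
    have : (2.1 : ℝ) < √5 := by rw [Real.lt_sqrt] <;> norm_num
    rw [realP_ten_one]
    linarith
  have hη2 : realP 10 1 < 1.65 := by
    have : √5 < (2.3 : ℝ) := by rw [Real.sqrt_lt'] <;> norm_num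
    rw [realP_ten_one]
    linarith
  have ha : ‖(1 + zeta 10) * (zeta 10 * (1 + zeta 10 ^ 2))‖ ^ 2 = 4 * realP 10 1 + 3 := by
    have h1 := norm_one_add_zeta_pow_sq 10 1
    rw [pow_one] at h1
    rw [norm_mul, norm_mul, norm_zeta, one_mul, mul_pow, h1, norm_one_add_zeta_pow_sq,
      show realP 10 2 = realP 10 1 ^ 2 - 2 from realP_two_mul 10 1]
    linear_combination (realP 10 1 + 3) * hη
  have hz : zeta 10 * conj (zeta 10) = 1 := by rw [Complex.mul_conj', norm_zeta]; simp
  have hz5 : zeta 10 ^ 5 = -1 := by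
    rw [zeta_pow_eq, show 2 * Real.pi * ((5 : ℕ) : ℝ) / (10 : ℕ) = Real.pi by push_cast; ring,
      Complex.exp_pi_mul_I]
  rw [hw]
  -- `a = (1 + ζ) / (1 - ζ) = i cot (π / 10)`, where `1 - ζ` is a unit with inverse `ζ (1 + ζ ^ 2)`
  refine isSchwarzTriangleGroup_two_self (r := 1) (δ := 4.8) (k := 5)
    (a := (1 + zeta 10) * (zeta 10 * (1 + zeta 10 ^ 2)))
    (by norm_num) (by norm_num) (by positivity) one_pos (by norm_num) ?_ ?_ ?_ ?_ ?_ ?_ ?_ ?_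
  · have hinv : conj (zeta 10) = -zeta 10 ^ 4 := by
      have h0 : zeta 10 ≠ 0 := by rw [← norm_ne_zero_iff, norm_zeta]; exact one_ne_zero
      refine mul_left_cancel₀ h0 ?_
      linear_combination hz + hz5
    rw [hz5]
    simp only [map_mul, map_add, map_one, map_pow, hinv]
    linear_combination (zeta 10 * (zeta 10 ^ 10 - zeta 10 ^ 5 + 1) + zeta 10 ^ 3 +
      zeta 10 ^ 2 * (1 - zeta 10 ^ 5)) * hz5
  · rw [ha]
    linear_combination -4 * hη
  · rw [ha]
    linear_combination (-2 * realP 10 1 - 2) * hη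
  · exact mul_mem (add_mem (one_mem _) (zeta_mem 10))
      (mul_mem (zeta_mem 10) (add_mem (one_mem _) (pow_mem (zeta_mem 10) 2)))
  · rw [Complex.ofReal_one]; exact one_mem _
  · push_cast
    exact mul_mem (mul_mem h2 (pow_mem hp 3)) (one_mem _)
  · linarith
  · intro A hA hc
    have hw0 : 0 < 2 * realP 10 1 ^ 3 := by positivity
    obtain ⟨h00, -⟩ := entries_of_mem_unitaryGroup hw0 (show toGLComplex 10 A ∈ _ from hA)
    have ha0 : toGLComplex 10 A 0 0 ≠ 0 := by
      intro h0
      rw [h0, norm_zero] at h00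
      have : 0 ≤ 2 * realP 10 1 ^ 3 * ‖toGLComplex 10 A 1 0‖ ^ 2 := by positivity
      linarith
    have hW : ∀ x : ℝ, aeval x (2 * X ^ 3 : ℤ[X]) = 2 * x ^ 3 := fun x => by
      rw [map_mul, map_pow, aeval_X, map_ofNat]
    obtain ⟨x, y, hx1, hy1, hxy, hx, hy⟩ := exists_conjugates (m := 10) (J := insert 1 {3})
      (by norm_num) (by decide) map_eq_prod_ten (2 * X ^ 3)
      (a := toGLComplex 10 A 0 0) (A 0 0).2 (c := toGLComplex 10 A 1 0) (A 1 0).2 ha0 hc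
      (by rw [hW]; exact h00)
    rw [Finset.prod_insert (by norm_num), Finset.prod_singleton] at hx hy
    obtain ⟨-, hy10, h1⟩ := hxy 1 (by simp)
    obtain ⟨hx30, hy30, h3⟩ := hxy 3 (by simp)
    rw [hW] at h1 h3
    rw [← hy1]
    -- `s` and `t` are conjugate up to sign, `2 ^ 2` being minus the norm of `w`
    obtain ⟨s, hs⟩ : ∃ s, s = 2 * realP 10 1 ^ 3 * y 1 := ⟨_, rfl⟩
    obtain ⟨t, ht⟩ : ∃ t, t = -(2 * realP 10 3 ^ 3 * y 3) := ⟨_, rfl⟩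
    have hprod : realP 10 1 * realP 10 3 = -1 := by
      rw [realP_ten_three]; linear_combination -hη
    have hst : s * t = 4 * (y 1 * y 3) := by
      rw [hs, ht]
      calc _ = -4 * (realP 10 1 * realP 10 3) ^ 3 * (y 1 * y 3) := by ring
        _ = _ := by rw [hprod]; ring
    have hs0 : 0 < s := by rw [hs]; positivity
    have hx1' : x 1 = 1 + s := by linarith
    have hx3' : x 3 = 1 - t := by linarith
    rw [hx1', hx3'] at hx
    rw [← hs]
    have hts : t + s * t ≤ s := by linarith
    have h4 : 4 * (1 + s) ≤ s ^ 2 := by nlinarith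
    nlinarith

/-! ### The group for `m = 18` -/

lemma realP_eighteen_seven : realP 18 7 = 2 - realP 18 1 ^ 2 := by
  rw [realP_eq_neg_of_add_eq (n := 9) (k := 2 * 1) (by norm_num) (by norm_num), realP_two_mul]
  ring

lemma realP_eighteen_one_cube : realP 18 1 ^ 3 = 3 * realP 18 1 + 1 := by
  have h := realP_three_mul 18 1
  rw [realP, show 2 * Real.pi * ((3 * 1 : ℕ) : ℝ) / (18 : ℕ) = Real.pi / 3 by push_cast; ring,
    Real.cos_pi_div_three] at h
  linarith

lemma realP_eighteen_five : realP 18 5 = realP 18 1 ^ 2 - realP 18 1 - 2 := by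
  rw [realP_eq_neg_of_add_eq (n := 9) (k := 2 * (2 * 1)) (by norm_num) (by norm_num),
    realP_two_mul, realP_two_mul]
  linear_combination -realP 18 1 * realP_eighteen_one_cube

lemma map_eq_prod_eighteen :
    (X ^ 3 - C 0 * X ^ 2 + C (-3) * X - C 1 : ℤ[X]).map (Int.castRingHom ℝ) =
      ∏ j ∈ insert 1 {5, 7}, (X - C (realP 18 j)) := by
  have h := realP_eighteen_one_cube
  rw [Finset.prod_insert (by decide), Finset.prod_insert (by decide), Finset.prod_singleton,
    realP_eighteen_five, realP_eighteen_seven]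
  refine map_cubic_eq ?_ ?_ ?_ <;> push_cast
  · ring
  · linear_combination (1 - realP 18 1) * h
  · linear_combination (-realP 18 1 ^ 2 + realP 18 1 + 1) * h

lemma isSchwarzTriangleGroup_two_three_eighteen :
    IsSchwarzTriangleGroup 2 3 18 (projGam 18 (p 18 1 * (p 18 1 + 2))) := by
  have hw : p 18 1 * (p 18 1 + 2) = ((realP 18 1 * (realP 18 1 + 2) : ℝ) : ℂ) := by
    rw [p_eq_realP]; push_cast; ring
  have hp : ((realP 18 1 : ℝ) : ℂ) ∈ cyclotomicIntegers 18 := by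
    have := p_mem 18 1 (by norm_num)
    rwa [p_eq_realP] at this
  have h2 : (2 : ℂ) ∈ cyclotomicIntegers 18 := by
    exact_mod_cast natCast_mem (cyclotomicIntegers 18) 2
  have hη := realP_eighteen_one_cube
  have hη1 : 1.7 < realP 18 1 := by
    have : (1.7 : ℝ) < √3 := by rw [Real.lt_sqrt] <;> norm_num
    exact this.trans_le (sqrt_three_le_realP (by norm_num))
  have hη2 : realP 18 1 < 1.9 := by
    by_contra! h
    nlinarith [mul_self_nonneg (realP 18 1 - 1.9)]
  have ha : ‖((realP 18 1 + 1 : ℝ) : ℂ)‖ = realP 18 1 + 1 := by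
    rw [Complex.norm_real, Real.norm_eq_abs, abs_of_pos (by linarith)]
  rw [hw]
  refine isSchwarzTriangleGroup_two_three (r := 1) (δ := 3) (k := 0) (a := (realP 18 1 + 1 : ℝ))
    (by norm_num) (by norm_num) (by positivity) one_pos (by norm_num) ?_ ?_ ?_ ?_ ?_ ?_ ?_ ?_
  · rw [Complex.conj_ofReal, pow_zero, one_mul]
  · rw [ha]
    linear_combination -hη
  · rw [ha]
    ring
  · push_cast
    exact add_mem hp (one_mem _)
  · rw [Complex.ofReal_one]; exact one_mem _
  · push_cast
    exact mul_mem (mul_mem hp (add_mem hp h2)) (one_mem _)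
  · linarith
  · intro A hA hc
    have hW : ∀ x : ℝ, aeval x (X * (X + 2) : ℤ[X]) = x * (x + 2) := fun x => by
      rw [map_mul, map_add, aeval_X, map_ofNat]
    refine le_mul_norm_sq_of_mem_Gam (J := {5, 7}) (by norm_num) (by decide) (by decide)
      map_eq_prod_eighteen (X * (X + 2)) (by positivity) (hW _) ?_ ?_ hA hc
    · intro j hj
      rw [hW]
      rcases Finset.mem_insert.mp hj with rfl | hj
      · rw [realP_eighteen_five]
        refine mul_nonpos_of_nonpos_of_nonneg ?_ ?_ <;> nlinarith
      · rw [Finset.mem_singleton.mp hj, realP_eighteen_seven]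
        refine mul_nonpos_of_nonpos_of_nonneg ?_ ?_ <;> nlinarith
    · rw [Finset.prod_insert (by decide), Finset.prod_singleton, hW, hW, realP_eighteen_five,
        realP_eighteen_seven]
      have e1 : realP 18 1 * (realP 18 1 ^ 2 - realP 18 1 - 2) * (2 - realP 18 1 ^ 2) = 1 := by
        linear_combination (-realP 18 1 ^ 2 + realP 18 1 + 1) * hη
      have e2 : (realP 18 1 + 2) * (realP 18 1 ^ 2 - realP 18 1 - 2 + 2) *
          (2 - realP 18 1 ^ 2 + 2) = 3 := by
        linear_combination (-realP 18 1 ^ 2 - realP 18 1 + 3) * hη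
      rw [← e2, ← one_mul ((realP 18 1 + 2) * _ * _), ← e1]
      ring

/-! ### The group for `m = 14` -/

lemma realP_fourteen_five : realP 14 5 = 2 - realP 14 1 ^ 2 := by
  rw [realP_eq_neg_of_add_eq (n := 7) (k := 2 * 1) (by norm_num) (by norm_num), realP_two_mul]
  ring

lemma realP_fourteen_one_cube : realP 14 1 ^ 3 = realP 14 1 ^ 2 + 2 * realP 14 1 - 1 := by
  have h := realP_three_mul 14 1
  rw [realP_eq_neg_of_add_eq (n := 7) (k := 2 * (2 * 1)) (by norm_num) (by norm_num),
    realP_two_mul, realP_two_mul] at h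
  have h1 := (Real.sqrt_nonneg 3).trans (sqrt_three_le_realP (m := 14) (by norm_num))
  have h2 : (realP 14 1 + 2) * (realP 14 1 ^ 3 - (realP 14 1 ^ 2 + 2 * realP 14 1 - 1)) = 0 := by
    linear_combination -h
  exact sub_eq_zero.mp ((mul_eq_zero.mp h2).resolve_left (by linarith))

lemma realP_fourteen_three : realP 14 3 = realP 14 1 ^ 2 - realP 14 1 - 1 := by
  rw [show realP 14 3 = _ from realP_three_mul 14 1]
  linear_combination realP_fourteen_one_cube

lemma map_eq_prod_fourteen :
    (X ^ 3 - C 1 * X ^ 2 + C (-2) * X - C (-1) : ℤ[X]).map (Int.castRingHom ℝ) =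
      ∏ j ∈ insert 1 {3, 5}, (X - C (realP 14 j)) := by
  have h := realP_fourteen_one_cube
  rw [Finset.prod_insert (by decide), Finset.prod_insert (by decide), Finset.prod_singleton,
    realP_fourteen_three, realP_fourteen_five]
  refine map_cubic_eq ?_ ?_ ?_ <;> push_cast
  · ring
  · linear_combination -realP 14 1 * h
  · linear_combination (1 - realP 14 1 ^ 2) * h

lemma isSchwarzTriangleGroup_two_three_fourteen :
    IsSchwarzTriangleGroup 2 3 14 (projGam 14 (-p 14 5)⁻¹) := by
  have hη := realP_fourteen_one_cube
  have hη1 : 1.7 < realP 14 1 := by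
    have : (1.7 : ℝ) < √3 := by rw [Real.lt_sqrt] <;> norm_num
    exact this.trans_le (sqrt_three_le_realP (by norm_num))
  have hη2 : realP 14 1 < 1.85 := by
    by_contra! h
    nlinarith [mul_self_nonneg (realP 14 1 - 1.85)]
  have hw : (-p 14 5)⁻¹ = ((realP 14 1 - 1 : ℝ) : ℂ) := by
    refine inv_eq_of_mul_eq_one_right ?_
    rw [p_eq_realP, realP_fourteen_five]
    have : -(2 - realP 14 1 ^ 2) * (realP 14 1 - 1) = 1 := by linear_combination hη
    exact_mod_cast this
  have hp : ((realP 14 1 : ℝ) : ℂ) ∈ cyclotomicIntegers 14 := by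
    have := p_mem 14 1 (by norm_num)
    rwa [p_eq_realP] at this
  have hr0 : 0 < realP 14 1 ^ 2 - 1 := by nlinarith
  have ha : ‖((realP 14 1 ^ 2 - 1 : ℝ) : ℂ)‖ = realP 14 1 ^ 2 - 1 := by
    rw [Complex.norm_real, Real.norm_eq_abs, abs_of_pos hr0]
  have hrm : ((realP 14 1 ^ 2 - 1 : ℝ) : ℂ) ∈ cyclotomicIntegers 14 := by
    push_cast
    exact sub_mem (pow_mem hp 2) (one_mem _)
  have hsq : (realP 14 1 ^ 2 - 1) ^ 2 * (2 - realP 14 1) = 1 := by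
    linear_combination (-realP 14 1 ^ 2 + realP 14 1 + 1) * hη
  rw [hw]
  refine isSchwarzTriangleGroup_two_three (r := realP 14 1 ^ 2 - 1) (δ := 1) (k := 0)
    (a := (realP 14 1 ^ 2 - 1 : ℝ))
    (by norm_num) (by norm_num) (by linarith) hr0 one_pos ?_ ?_ ?_ hrm hrm ?_ ?_ ?_
  · rw [Complex.conj_ofReal, pow_zero, one_mul]
  · rw [ha, hsq]
  · rw [ha]
    linear_combination hsq
  · rw [Complex.ofReal_mul]
    refine mul_mem ?_ hrm
    push_cast
    exact sub_mem hp (one_mem _)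
  · linarith
  · intro A hA hc
    have hW : ∀ x : ℝ, aeval x (X - 1 : ℤ[X]) = x - 1 := fun x => by
      rw [map_sub, aeval_X, map_one]
    refine le_mul_norm_sq_of_mem_Gam (J := {3, 5}) (by norm_num) (by decide) (by decide)
      map_eq_prod_fourteen (X - 1) (by linarith) (hW _) ?_ ?_ hA hc
    · intro j hj
      rw [hW]
      rcases Finset.mem_insert.mp hj with rfl | hj
      · rw [realP_fourteen_three]
        nlinarith
      · rw [Finset.mem_singleton.mp hj, realP_fourteen_five]
        nlinarith
    · rw [Finset.prod_insert (by decide), Finset.prod_singleton, hW, hW, realP_fourteen_three,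
        realP_fourteen_five]
      linear_combination (realP 14 1 ^ 2 - realP 14 1 - 1) * hη

end

end TriangleGroups

theorem theorem3p6 :
    TriangleGroups.IsSchwarzTriangleGroup 2 12 12
      (TriangleGroups.projGam 12
        (2 * TriangleGroups.p 12 1 * (TriangleGroups.p 12 1 + 2))) ∧
    TriangleGroups.IsSchwarzTriangleGroup 2 10 10
      (TriangleGroups.projGam 10 (2 * TriangleGroups.p 10 1 ^ 3)) ∧
    TriangleGroups.IsSchwarzTriangleGroup 2 3 18
      (TriangleGroups.projGam 18
        (TriangleGroups.p 18 1 * (TriangleGroups.p 18 1 + 2))) ∧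
    TriangleGroups.IsSchwarzTriangleGroup 2 3 14
      (TriangleGroups.projGam 14 (-TriangleGroups.p 14 5)⁻¹) ∧
    TriangleGroups.IsSchwarzTriangleGroup 2 3 12
      (TriangleGroups.projGam 12 (TriangleGroups.p 12 1 + 1)⁻¹) :=
  ⟨TriangleGroups.isSchwarzTriangleGroup_two_twelve_twelve,
    TriangleGroups.isSchwarzTriangleGroup_two_ten_ten,
    TriangleGroups.isSchwarzTriangleGroup_two_three_eighteen,
    TriangleGroups.isSchwarzTriangleGroup_two_three_fourteen,
    TriangleGroups.isSchwarzTriangleGroup_two_three_twelve⟩
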